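/- Let $\ell\ge 1$ be an integer and let $\mathfrak g_\ell$ be the complex Lie algebra ($d=1$ conformal Galilei algebra) with basis $D,H,C,P_0,\dots,P_{2\ell}$ and nonvanishing brackets $$[D,H]=H,\quad [D,C]=-C,\quad [C,H]=2D,\quad [H,P_n]=-nP_{n-1},\quad [D,P_n]=(\ell-n)P_n,\quad [C,P_n]=(2\ell-n)P_{n+1}.$$ Put $\mathfrak g_\ell^-=\langle C,P_{\ell+1},\dots,P_{2\ell}\rangle$ and $\mathfrak b=\langle D,P_\ell\rangle\oplus\mathfrak g_\ell^-$. For $\delta,p\in\mathbb C$ let $V_\ell^{\delta,p}=U(\mathfrak g_\ell)\otimes_{U(\mathfrak b)}\mathbb C|\delta,p\rangle$ be the Verma module, where $D|\delta,p\rangle=\delta|\delta,p\rangle$, $P_\ell|\delta,p\rangle=p|\delta,p\rangle$ and $\mathfrak g_\ell^-|\delta,p\rangle=0$. In every quotient of $V_\ell^{\delta,p}$ write $u_0$ for the image of $|\delta,p\rangle$. A lowest weight module of weight $(\delta,p)$ is a module generated by a nonzero vector $u_0$ with $Du_0=\delta u_0$, $P_\ell u_0=pu_0$, $\mathfrak g_\ell^-u_0=0$.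 Then the following $\mathfrak g_\ell$-modules are irreducible lowest weight modules, with lowest weight vector $u_0$ of weight $(\delta,p)$. **Case $p\ne0$.** (i) For $\ell=1$: the Verma module $V_1^{\delta,p}$. (ii) For $\ell\ge2$: the iterated quotient $V_\ell^{(\ell)}=V_\ell^{\delta,p}/\mathcal I^{(2)}/\cdots/\mathcal I^{(\ell)}$, where $V_\ell^{(1)}=V_\ell^{\delta,p}$, $V_\ell^{(n)}=V_\ell^{(n-1)}/\mathcal I^{(n)}$, and $\mathcal I^{(n)}$ is the submodule of $V_\ell^{(n-1)}$ generated by $$\bigl(n!\,p^{n-1}(\ell+1)^{n-1}P_{\ell-n}-(\ell+2)(\ell+3)\cdots(\ell+n)\,P_{\ell-1}^{\,n}\bigr)u_0 .$$ In $V_\ell^{(\ell)}$ one has, for $2\le a\le\ell$, $$P_{\ell-a}u_0=\frac{(\ell+2)\cdots(\ell+a)}{a!\,p^{a-1}(\ell+1)^{a-1}}\,P_{\ell-1}^{\,a}u_0 ,$$ and $V_\ell^{(\ell)}$ is infinite-dimensional with basis $H^kP_{\ell-1}^m u_0$, $k,m\in\mathbb Z_{\ge0}$. **Case $p=0$.**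 Let $V_\ell^{(0)}=V_\ell^{\delta,0}$ and, for $1\le n\le\ell$, let $V_\ell^{(n)}$ be the quotient of $V_\ell^{(n-1)}$ by the submodule generated by $P_{\ell-n}u_0$. (i) If $2\delta+k=0$ for some integer $k\ge0$: the quotient of $V_\ell^{(\ell)}$ by the submodule generated by $H^{k+1}u_0$. All $P_n$ act on it by zero, and as a module over $\langle H,D,C\rangle\cong\mathfrak{sl}(2)$ it is isomorphic to the $(k+1)$-dimensional irreducible module, the $k$-th symmetric power of the natural module; its dimension is $k+1=2|\delta|+1$. (ii) If $2\delta+k\ne0$ for every integer $k\ge0$: the module $V_\ell^{(\ell)}$. All $P_n$ act on it by zero, and as a module over $\langle H,D,C\rangle\cong\mathfrak{sl}(2)$ it is isomorphic to the infinite-dimensional lowest weight module with basis $|j\rangle$, $j\ge0$, on which $H|j\rangle=|j+1\rangle$, $D|j\rangle=(\delta+j)|j\rangle$, $C|j\rangle=j(2\delta+j-1)|j-1\rangle$ (where the last is $0$ for $j=0$). -/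

import Mathlib

noncomputable section

/-! ## The conformal Galilei algebra with `d = 1` and integer spin `l` -/

/-- The underlying complex vector space of the `d = 1` conformal Galilei algebra of integer spin `l`.
The element with entries `d h c a` stands for `d D + h H + c C + ∑ n, a n P_n`, where `n` runs over
`0, 1, …, 2 l`. -/
@[ext] structure CGA (l : ℕ) where
  d : ℂ
  h : ℂ
  c : ℂ
  a : Fin (2 * l + 1) → ℂ

namespace CGA

variable {l : ℕ}

instance : Zero (CGA l) := ⟨⟨0, 0, 0, 0⟩⟩
instance : Add (CGA l) := ⟨fun x y => ⟨x.d + y.d, x.h + y.h, x.c + y.c, x.a + y.a⟩⟩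
instance : Neg (CGA l) := ⟨fun x => ⟨-x.d, -x.h, -x.c, -x.a⟩⟩
instance : SMul ℂ (CGA l) := ⟨fun r x => ⟨r * x.d, r * x.h, r * x.c, r • x.a⟩⟩

@[simp] theorem zero_d : (0 : CGA l).d = 0 := rfl
@[simp] theorem zero_h : (0 : CGA l).h = 0 := rfl
@[simp] theorem zero_c : (0 : CGA l).c = 0 := rfl
@[simp] theorem zero_a : (0 : CGA l).a = 0 := rfl
@[simp] theorem add_d (x y : CGA l) : (x + y).d = x.d + y.d := rfl
@[simp] theorem add_h (x y : CGA l) : (x + y).h = x.h + y.h := rfl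
@[simp] theorem add_c (x y : CGA l) : (x + y).c = x.c + y.c := rfl
@[simp] theorem add_a (x y : CGA l) : (x + y).a = x.a + y.a := rfl
@[simp] theorem neg_d (x : CGA l) : (-x).d = -x.d := rfl
@[simp] theorem neg_h (x : CGA l) : (-x).h = -x.h := rfl
@[simp] theorem neg_c (x : CGA l) : (-x).c = -x.c := rfl
@[simp] theorem neg_a (x : CGA l) : (-x).a = -x.a := rfl
@[simp] theorem smul_d (r : ℂ) (x : CGA l) : (r • x).d = r * x.d := rfl
@[simp] theorem smul_h (r : ℂ) (x : CGA l) : (r • x).h = r * x.h := rfl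
@[simp] theorem smul_c (r : ℂ) (x : CGA l) : (r • x).c = r * x.c := rfl
@[simp] theorem smul_a (r : ℂ) (x : CGA l) : (r • x).a = r • x.a := rfl

instance : AddCommGroup (CGA l) where
  add_assoc x y z := by ext <;> simp [add_assoc]
  zero_add x := by ext <;> simp
  add_zero x := by ext <;> simp
  add_comm x y := by ext <;> simp [add_comm]
  neg_add_cancel x := by ext <;> simp
  nsmul := nsmulRec
  zsmul := zsmulRec

instance : Module ℂ (CGA l) where
  one_smul x := by ext <;> simp
  mul_smul r s x := by ext <;> simp [mul_assoc]
  smul_zero r := by ext <;> simp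
  smul_add r x y := by ext <;> simp [mul_add]
  add_smul r s x := by ext <;> simp [add_mul]
  zero_smul x := by ext <;> simp

/-- The coefficient of `P_n`, with the convention that it is `0` unless `0 ≤ n ≤ 2 l`. -/
def coef (a : Fin (2 * l + 1) → ℂ) (n : ℤ) : ℂ :=
  if h : 0 ≤ n ∧ n ≤ 2 * l then a ⟨n.toNat, by omega⟩ else 0

theorem coef_natCast (a : Fin (2 * l + 1) → ℂ) (n : Fin (2 * l + 1)) : coef a (n : ℕ) = a n := by
  have := n.2
  rw [coef, dif_pos (by omega)]
  simp

theorem coef_neg {a : Fin (2 * l + 1) → ℂ} {n : ℤ} (h : n < 0) : coef a n = 0 := by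
  rw [coef, dif_neg (by omega)]

theorem coef_gt {a : Fin (2 * l + 1) → ℂ} {n : ℤ} (h : 2 * l < n) : coef a n = 0 := by
  rw [coef, dif_neg (by omega)]

@[simp] theorem coef_add (a b : Fin (2 * l + 1) → ℂ) (n : ℤ) :
    coef (a + b) n = coef a n + coef b n := by
  unfold coef; split_ifs <;> simp

@[simp] theorem coef_sub (a b : Fin (2 * l + 1) → ℂ) (n : ℤ) :
    coef (a - b) n = coef a n - coef b n := by
  unfold coef; split_ifs <;> simp

@[simp] theorem coef_smul (r : ℂ) (a : Fin (2 * l + 1) → ℂ) (n : ℤ) :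
    coef (r • a) n = r * coef a n := by
  unfold coef; split_ifs <;> simp

theorem ext_coef {a b : Fin (2 * l + 1) → ℂ} (h : ∀ n, coef a n = coef b n) : a = b := by
  funext n
  rw [← coef_natCast a n, ← coef_natCast b n, h]

/-- The coefficients of `[d D + h H + c C, ∑ n, a n P_n]`, computed from
`[D, P_n] = (l - n) P_n`, `[H, P_n] = - n P_{n-1}` and `[C, P_n] = (2 l - n) P_{n+1}`. -/
def act (x : CGA l) (a : Fin (2 * l + 1) → ℂ) : Fin (2 * l + 1) → ℂ := fun n =>
  x.d * (l - (n : ℕ)) * coef a (n : ℕ) - x.h * ((n : ℕ) + 1) * coef a ((n : ℕ) + 1)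
    + x.c * (2 * l - (n : ℕ) + 1) * coef a ((n : ℕ) - 1)

theorem coef_act (x : CGA l) (a : Fin (2 * l + 1) → ℂ) (n : ℤ) :
    coef (act x a) n = x.d * (l - n) * coef a n - x.h * (n + 1) * coef a (n + 1)
      + x.c * (2 * l - n + 1) * coef a (n - 1) := by
  by_cases h : 0 ≤ n ∧ n ≤ 2 * l
  · obtain ⟨m, rfl⟩ := Int.eq_ofNat_of_zero_le h.1
    have hm : m < 2 * l + 1 := by omega
    have := coef_natCast (act x a) ⟨m, hm⟩
    simp only at this
    rw [this]
    simp [act]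
  · rcases not_and_or.mp h with h | h
    · rw [coef_neg (by omega), coef_neg (n := n) (by omega), coef_neg (n := n - 1) (by omega)]
      rcases eq_or_ne n (-1) with rfl | h'
      · simp
      · rw [coef_neg (n := n + 1) (by omega)]; simp
    · rw [coef_gt (by omega), coef_gt (n := n) (by omega), coef_gt (n := n + 1) (by omega)]
      rcases eq_or_ne n (2 * l + 1) with rfl | h'
      · simp
      · rw [coef_gt (n := n - 1) (by omega)]; simp

/-- The Lie bracket: `[D, H] = H`, `[D, C] = - C`, `[C, H] = 2 D`, the brackets with the `P_n` as
above, and the `P_n` commute. The generators and their relations are spelled out below. -/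
instance : Bracket (CGA l) (CGA l) where
  bracket x y :=
    ⟨2 * (x.c * y.h - x.h * y.c), x.d * y.h - x.h * y.d, -(x.d * y.c - x.c * y.d),
      act x y.a - act y x.a⟩

@[simp] theorem lie_d (x y : CGA l) : ⁅x, y⁆.d = 2 * (x.c * y.h - x.h * y.c) := rfl
@[simp] theorem lie_h (x y : CGA l) : ⁅x, y⁆.h = x.d * y.h - x.h * y.d := rfl
@[simp] theorem lie_c (x y : CGA l) : ⁅x, y⁆.c = -(x.d * y.c - x.c * y.d) := rfl
@[simp] theorem lie_a (x y : CGA l) : ⁅x, y⁆.a = act x y.a - act y x.a := rfl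

instance : LieRing (CGA l) where
  add_lie x y z := by
    ext1
    · simp; ring
    · simp; ring
    · simp; ring
    · apply ext_coef; intro n; simp [coef_act]; ring
  lie_add x y z := by
    ext1
    · simp; ring
    · simp; ring
    · simp; ring
    · apply ext_coef; intro n; simp [coef_act]; ring
  lie_self x := by
    ext1
    · simp; ring
    · simp; ring
    · simp; ring
    · simp
  leibniz_lie x y z := by
    ext1
    · simp; ring
    · simp; ring
    · simp; ring
    · apply ext_coef; intro n; simp [coef_act]; ring

instance : LieAlgebra ℂ (CGA l) where
  lie_smul r x y := by
    ext1
    · simp; ring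
    · simp; ring
    · simp; ring
    · apply ext_coef; intro n; simp [coef_act]; ring

variable (l)

/-- The generator `D` (dilatation). -/
def D : CGA l := ⟨1, 0, 0, 0⟩
/-- The generator `H` (time translation). -/
def H : CGA l := ⟨0, 1, 0, 0⟩
/-- The generator `C` (special conformal transformation). -/
def C : CGA l := ⟨0, 0, 1, 0⟩
/-- The generators `P_n`, `0 ≤ n ≤ 2 l` (and `P_n = 0` for `n > 2 l`, a case that is never used). -/
def P (n : ℕ) : CGA l := ⟨0, 0, 0, fun i => if (i : ℕ) = n then 1 else 0⟩

theorem coef_P (n : ℕ) (hn : n ≤ 2 * l) (m : ℤ) : coef (P l n).a m = if m = n then 1 else 0 := by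
  by_cases h : 0 ≤ m ∧ m ≤ 2 * l
  · rw [coef, dif_pos h]
    simp only [P]
    congr 1
    simp only [eq_iff_iff]
    omega
  · rw [coef, dif_neg h, if_neg (by omega)]

theorem coef_zero (m : ℤ) : coef (0 : Fin (2 * l + 1) → ℂ) m = 0 := by simp [coef]

theorem lie_D_H : ⁅D l, H l⁆ = H l := by
  ext1 <;> try (simp [D, H]; done)
  apply ext_coef; intro m; simp [coef_act, coef_zero, D, H]

theorem lie_D_C : ⁅D l, C l⁆ = -C l := by
  ext1 <;> try (simp [D, C]; done)
  apply ext_coef; intro m; simp [coef_act, coef_zero, D, C]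

theorem lie_C_H : ⁅C l, H l⁆ = (2 : ℂ) • D l := by
  ext1 <;> try (simp [D, H, C]; done)
  apply ext_coef; intro m; simp [coef_act, coef_zero, D, H, C]

theorem lie_P_P (m n : ℕ) : ⁅P l m, P l n⁆ = 0 := by
  ext1 <;> try (simp [P]; done)
  apply ext_coef; intro i; simp [coef_act, coef_zero, P]

theorem lie_D_P (n : ℕ) (hn : n ≤ 2 * l) : ⁅D l, P l n⁆ = ((l : ℂ) - n) • P l n := by
  ext1 <;> try (simp [P, D]; done)
  apply ext_coef; intro m
  simp only [lie_a, coef_sub, coef_act, smul_a, coef_smul, coef_P l n hn]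
  by_cases h : m = n
  · simp [D, P, h, coef_zero]
  · simp [D, P, h, coef_zero]

theorem lie_H_P_zero : ⁅H l, P l 0⁆ = 0 := by
  ext1 <;> try (simp [P, H]; done)
  apply ext_coef; intro m
  simp only [lie_a, coef_sub, coef_act, coef_P l 0 (Nat.zero_le _)]
  by_cases h : m = -1
  · simp [H, P, h, coef_zero]
  · have : ¬ (m + 1 = 0) := by omega
    simp [H, P, this, coef_zero]

theorem lie_H_P_succ (n : ℕ) (hn : n + 1 ≤ 2 * l) :
    ⁅H l, P l (n + 1)⁆ = (-((n : ℂ) + 1)) • P l n := by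
  ext1 <;> try (simp [P, H]; done)
  apply ext_coef; intro m
  simp only [lie_a, coef_sub, coef_act, smul_a, coef_smul, coef_P l n (by omega),
    coef_P l (n + 1) hn]
  by_cases h : m = n
  · simp [H, P, h, coef_zero]
  · simp [H, P, h, coef_zero]

theorem lie_C_P (n : ℕ) (hn : n ≤ 2 * l) :
    ⁅C l, P l n⁆ = ((2 * l : ℂ) - n) • P l (n + 1) := by
  ext1 <;> try (simp [P, C]; done)
  rcases hn.eq_or_lt with rfl | hn'
  · apply ext_coef; intro m
    simp only [lie_a, coef_sub, coef_act, smul_a, coef_smul, coef_P l _ hn]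
    by_cases h : m = 2 * l + 1
    · simp [C, P, h, coef_zero]
    · have : ¬ (m - 1 = 2 * l) := by omega
      simp [C, P, this, coef_zero]
  · apply ext_coef; intro m
    simp only [lie_a, coef_sub, coef_act, smul_a, coef_smul, coef_P l n hn,
      coef_P l (n + 1) (by omega)]
    by_cases h : m = n + 1
    · simp [C, P, h, coef_zero]; ring
    · have : ¬ (m - 1 = n) := by omega
      simp [C, P, h, this, coef_zero]

/-! ### Triangular decomposition -/

/-- `𝔤⁰ = ⟨D, P_l⟩`. -/
def gZero : Submodule ℂ (CGA l) := Submodule.span ℂ {D l, P l l}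

/-- `𝔤⁻ = ⟨C, P_{l+1}, …, P_{2l}⟩`. -/
def gMinus : Submodule ℂ (CGA l) :=
  Submodule.span ℂ ({C l} ∪ {x | ∃ n, l < n ∧ n ≤ 2 * l ∧ x = P l n})

/-- The subalgebra `𝔟 = 𝔤⁰ ⊕ 𝔤⁻`: no components along `H, P_0, …, P_{l-1}`. -/
def borel : LieSubalgebra ℂ (CGA l) where
  carrier := {x | x.h = 0 ∧ ∀ n : ℤ, n < l → coef x.a n = 0}
  zero_mem' := by simp [coef_zero]
  add_mem' := by
    rintro x y ⟨hx, hx'⟩ ⟨hy, hy'⟩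
    refine ⟨by simp [hx, hy], fun n hn => by simp [hx' n hn, hy' n hn]⟩
  smul_mem' := by
    rintro r x ⟨hx, hx'⟩
    refine ⟨by simp [hx], fun n hn => by simp [hx' n hn]⟩
  lie_mem' := by
    rintro x y ⟨hx, hx'⟩ ⟨hy, hy'⟩
    refine ⟨by simp [hx, hy], fun n hn => ?_⟩
    simp [coef_act, hx, hy, hx' n hn, hy' n hn, hx' (n - 1) (by omega), hy' (n - 1) (by omega)]

theorem mem_borel {x : CGA l} : x ∈ borel l ↔ x.h = 0 ∧ ∀ n : ℤ, n < l → coef x.a n = 0 := Iff.rfl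

theorem eq_sum (x : CGA l) :
    x = x.d • D l + x.h • H l + x.c • C l + ∑ n : Fin (2 * l + 1), x.a n • P l n := by
  have key : ∀ s : Finset (Fin (2 * l + 1)), (∑ n ∈ s, x.a n • P l n) =
      ⟨0, 0, 0, fun i => ∑ n ∈ s, if (i : ℕ) = n then x.a n else 0⟩ := by
    classical
    intro s
    induction s using Finset.induction_on with
    | empty => rfl
    | insert n s hn ih =>
      rw [Finset.sum_insert hn, ih]
      ext1
      · simp [P]
      · simp [P]
      · simp [P]
      · funext i
        simp [P, Finset.sum_insert hn]
  rw [key]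
  ext1
  · simp [D, H, C]
  · simp [D, H, C]
  · simp [D, H, C]
  · funext i
    simp [D, H, C, ← Fin.ext_iff]

theorem borel_toSubmodule : (borel l).toSubmodule = gZero l ⊔ gMinus l := by
  apply le_antisymm
  · intro x hx
    have hx : x.h = 0 ∧ ∀ n : ℤ, n < l → coef x.a n = 0 := hx
    have hD : D l ∈ gZero l ⊔ gMinus l :=
      Submodule.mem_sup_left (Submodule.subset_span (by simp))
    have hC : C l ∈ gZero l ⊔ gMinus l :=
      Submodule.mem_sup_right (Submodule.subset_span (by simp))
    rw [eq_sum l x, hx.1, zero_smul, add_zero]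
    refine add_mem (add_mem (Submodule.smul_mem _ _ hD) (Submodule.smul_mem _ _ hC)) ?_
    refine Submodule.sum_mem _ fun n _ => ?_
    rcases lt_trichotomy (n : ℕ) l with h | h | h
    · have := hx.2 n (by exact_mod_cast h)
      rw [coef_natCast] at this
      simp [this]
    · refine Submodule.smul_mem _ _ (Submodule.mem_sup_left (Submodule.subset_span ?_))
      simp [h]
    · refine Submodule.smul_mem _ _ (Submodule.mem_sup_right (Submodule.subset_span ?_))
      exact Or.inr ⟨n, h, by omega, rfl⟩
  · have hP : ∀ n : ℕ, l ≤ n → n ≤ 2 * l → P l n ∈ (borel l).toSubmodule := fun n h h' => by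
      refine ⟨rfl, fun m hm => ?_⟩
      rw [coef_P l n h', if_neg (by omega)]
    refine sup_le (Submodule.span_le.2 ?_) (Submodule.span_le.2 ?_)
    · rintro x (rfl | rfl)
      · exact ⟨rfl, fun m _ => coef_zero l m⟩
      · exact hP l le_rfl (by omega)
    · rintro x (rfl | ⟨n, h, h', rfl⟩)
      · exact ⟨rfl, fun m _ => coef_zero l m⟩
      · exact hP n h.le h'

/-! ### Verma modules -/

/-- The enveloping algebra `U(𝔤)`. -/
abbrev U := UniversalEnvelopingAlgebra ℂ (CGA l)

/-- The enveloping algebra `U(𝔟)`. -/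
abbrev UBorel := UniversalEnvelopingAlgebra ℂ (borel l)

section
attribute [local instance 100] LieRing.ofAssociativeRing

/-- The algebra map `U(𝔟) → U(𝔤)` induced by the inclusion. -/
def incl : UBorel l →ₐ[ℂ] U l :=
  UniversalEnvelopingAlgebra.lift ℂ
    ((UniversalEnvelopingAlgebra.ι ℂ : CGA l →ₗ⁅ℂ⁆ U l).comp (borel l).incl)

/-- The one-dimensional representation of `𝔟` on which `D` acts by `δ`, `P_l` by `p`, and `𝔤⁻`
by zero. -/
def lieCharacter (δ p : ℂ) : borel l →ₗ⁅ℂ⁆ ℂ where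
  toFun x := δ * x.1.d + p * coef x.1.a l
  map_add' x y := by simp; ring
  map_smul' r x := by simp; ring
  map_lie' := by
    rintro ⟨x, hx, hx'⟩ ⟨y, hy, hy'⟩
    simp [LieRing.of_associative_ring_bracket, coef_act, hx, hy, hx' (l - 1) (by omega),
      hy' (l - 1) (by omega), mul_comm]

/-- The corresponding representation of `U(𝔟)`. -/
def character (δ p : ℂ) : UBorel l →ₐ[ℂ] ℂ :=
  UniversalEnvelopingAlgebra.lift ℂ (lieCharacter l δ p)

end

/-- The action of a Lie algebra element through `U(𝔤)`. -/
abbrev ι (x : CGA l) : U l := UniversalEnvelopingAlgebra.ι ℂ x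

open scoped TensorProduct

/-- The relations `u b ⊗ z = u ⊗ b z` (`u ∈ U(𝔤)`, `b ∈ U(𝔟)`), where `b` acts on `z ∈ ℂ` through the
character `(δ, p)`. -/
def vermaRel (δ p : ℂ) : Submodule (U l) (U l ⊗[ℂ] ℂ) :=
  Submodule.span (U l) {t | ∃ (u : U l) (b : UBorel l) (z : ℂ),
    t = (u * incl l b) ⊗ₜ[ℂ] z - u ⊗ₜ[ℂ] (character l δ p b * z)}

end CGA

open CGA

/-- A `𝔤`-module (as a `U(𝔤)`-module, with the complex vector space structure that comes with it)
together with a chosen vector. -/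
structure PointedModule (l : ℕ) where
  carrier : Type
  [addCommGroup : AddCommGroup carrier]
  [module : Module (U l) carrier]
  [moduleC : Module ℂ carrier]
  [isScalarTower : IsScalarTower ℂ (U l) carrier]
  u₀ : carrier

namespace PointedModule

attribute [instance] addCommGroup module moduleC isScalarTower

variable {l : ℕ}

/-- The quotient of a module by the submodule generated by a vector `v`, pointed by the class of the
chosen vector. If `v` is a singular vector, the submodule is `U(𝔤⁺) v`. -/
def quot (M : PointedModule l) (v : M.carrier) : PointedModule l where
  carrier := M.carrier ⧸ Submodule.span (U l) {v}
  u₀ := Submodule.Quotient.mk M.u₀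

/-- `M` is a lowest weight module with lowest weight vector `u₀` of weight `(δ, p)`:
`u₀ ≠ 0` generates `M`, `D u₀ = δ u₀`, `P_l u₀ = p u₀`, and `𝔤⁻ u₀ = 0`. -/
structure IsLowestWeight (M : PointedModule l) (δ p : ℂ) : Prop where
  ne_zero : M.u₀ ≠ 0
  span_eq_top : Submodule.span (U l) {M.u₀} = ⊤
  D_smul : ι l (D l) • M.u₀ = δ • M.u₀
  P_smul : ι l (P l l) • M.u₀ = p • M.u₀
  minus_smul : ∀ x ∈ gMinus l, ι l x • M.u₀ = 0

/-- `M` is an irreducible lowest weight module of weight `(δ, p)`. -/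
def IsIrreducibleLowestWeight (M : PointedModule l) (δ p : ℂ) : Prop :=
  M.IsLowestWeight δ p ∧ IsSimpleModule (U l) M.carrier

end PointedModule

open scoped TensorProduct in
/-- The Verma module `V_l^{δ,p} = U(𝔤) ⊗_{U(𝔟)} ℂ |δ,p⟩`, with its lowest weight vector. -/
def verma (l : ℕ) (δ p : ℂ) : PointedModule l where
  carrier := (U l ⊗[ℂ] ℂ) ⧸ vermaRel l δ p
  u₀ := Submodule.Quotient.mk (1 ⊗ₜ[ℂ] 1)

/-! ## The iterated quotients -/

/-- For `p ≠ 0`: the vector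
`n! p^{n-1} (l+1)^{n-1} P_{l-n} u₀ - (l+2) (l+3) ⋯ (l+n) P_{l-1}^n u₀`, `2 ≤ n ≤ l`. -/
def singularVector {l : ℕ} (p : ℂ) (n : ℕ) (M : PointedModule l) : M.carrier :=
  ((n.factorial : ℂ) * p ^ (n - 1) * ((l : ℂ) + 1) ^ (n - 1)) • ι l (P l (l - n)) • M.u₀
    - (∏ i ∈ Finset.Icc 2 n, ((l : ℂ) + i)) • (ι l (P l (l - 1)) ^ n) • M.u₀

/-- For `p ≠ 0`: the iterated quotient `V^(n) = V / I^(2) / ⋯ / I^(n)` of the Verma module, where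
`I^(n)` is the submodule of `V^(n-1)` generated by the singular vector above (and `V^(1) = V`). -/
def vermaQuot (l : ℕ) (δ p : ℂ) : ℕ → PointedModule l
  | 0 => verma l δ p
  | 1 => verma l δ p
  | n + 2 => (vermaQuot l δ p (n + 1)).quot (singularVector p (n + 2) (vermaQuot l δ p (n + 1)))

/-- For `p = 0`: the iterated quotient `V^(n) = V / I^(1) / ⋯ / I^(n)` of the Verma module, where
`I^(n)` is the submodule of `V^(n-1)` generated by `P_{l-n} u₀` (and `V^(0) = V`). -/
def vermaQuotZero (l : ℕ) (δ : ℂ) : ℕ → PointedModule l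
  | 0 => verma l δ 0
  | n + 1 => (vermaQuotZero l δ n).quot (ι l (P l (l - (n + 1))) • (vermaQuotZero l δ n).u₀)

/-- For `p = 0`: the quotient of `V^(l)` by the submodule generated by `H^{k+1} u₀`. -/
def vermaQuotFin (l : ℕ) (δ : ℂ) (k : ℕ) : PointedModule l :=
  (vermaQuotZero l δ l).quot ((ι l (H l) ^ (k + 1)) • (vermaQuotZero l δ l).u₀)

/-! ## Modules over `𝔰𝔩(2)` -/

/-- The Lie algebra `𝔰𝔩(2)` of traceless complex `2 × 2` matrices. -/
abbrev SL2 := LieAlgebra.SpecialLinear.sl (Fin 2) ℂ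

/-- The projection of `𝔤` onto `𝔤 / ⟨P_0, …, P_{2l}⟩ ≅ ⟨H, D, C⟩ ≅ 𝔰𝔩(2)`, where `D` corresponds to
`diag(1/2, -1/2)`, `H` to `E₁₂` and `C` to `- E₂₁`. -/
def toSL2 (l : ℕ) : CGA l →ₗ⁅ℂ⁆ SL2 where
  toFun x := ⟨!![x.d / 2, x.h; -x.c, -x.d / 2], by
    change Matrix.trace (!![x.d / 2, x.h; -x.c, -x.d / 2] : Matrix (Fin 2) (Fin 2) ℂ) = 0
    rw [Matrix.trace_fin_two_of]; ring⟩
  map_add' x y := by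
    apply Subtype.ext; ext i j; fin_cases i <;> fin_cases j <;> simp <;> ring
  map_smul' r x := by
    apply Subtype.ext; ext i j; fin_cases i <;> fin_cases j <;> simp <;> ring
  map_lie' {x y} := by
    apply Subtype.ext
    rw [LieAlgebra.SpecialLinear.sl_bracket]
    ext i j; fin_cases i <;> fin_cases j <;> simp <;> ring

section
attribute [local instance 100] LieRing.ofAssociativeRing

/-- The derivation of `ℂ[x, y]` induced by a matrix, acting on the linear span of the two
variables as the matrix acts on column vectors. -/
def matDerivation (A : Matrix (Fin 2) (Fin 2) ℂ) :
    Derivation ℂ (MvPolynomial (Fin 2) ℂ) (MvPolynomial (Fin 2) ℂ) :=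
  MvPolynomial.mkDerivation ℂ fun j => ∑ i, A i j • MvPolynomial.X i

theorem matDerivation_apply (A : Matrix (Fin 2) (Fin 2) ℂ) (f : MvPolynomial (Fin 2) ℂ) :
    matDerivation A f =
      ∑ j, ∑ i, A i j • (MvPolynomial.X i * MvPolynomial.pderiv j f) := by
  have h : matDerivation A = ∑ j, ∑ i, A i j • ((MvPolynomial.X i : MvPolynomial (Fin 2) ℂ) •
      (MvPolynomial.pderiv j : Derivation ℂ (MvPolynomial (Fin 2) ℂ) _)) := by
    apply MvPolynomial.derivation_ext
    intro m
    rw [matDerivation, MvPolynomial.mkDerivation_X]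
    fin_cases m <;> simp [Fin.sum_univ_two, MvPolynomial.pderiv_X]
  rw [h]
  simp [Fin.sum_univ_two]

theorem matDerivation_mem (A : Matrix (Fin 2) (Fin 2) ℂ) (k : ℕ) (f : MvPolynomial (Fin 2) ℂ)
    (hf : f ∈ MvPolynomial.homogeneousSubmodule (Fin 2) ℂ k) :
    matDerivation A f ∈ MvPolynomial.homogeneousSubmodule (Fin 2) ℂ k := by
  rw [matDerivation_apply]
  refine Submodule.sum_mem _ fun j _ => Submodule.sum_mem _ fun i _ => Submodule.smul_mem _ _ ?_
  rw [MvPolynomial.mem_homogeneousSubmodule] at hf ⊢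
  rcases k with _ | k
  · obtain ⟨c, rfl⟩ : ∃ c, f = MvPolynomial.C c :=
      ⟨_, MvPolynomial.totalDegree_eq_zero_iff_eq_C.1 (Nat.le_zero.1 hf.totalDegree_le)⟩
    simpa using MvPolynomial.isHomogeneous_zero _ _ _
  · simpa [add_comm] using (MvPolynomial.isHomogeneous_X ℂ i).mul (hf.pderiv (i := j))

theorem matDerivation_add (A B : Matrix (Fin 2) (Fin 2) ℂ) :
    matDerivation (A + B) = matDerivation A + matDerivation B := by
  apply MvPolynomial.derivation_ext
  intro m
  simp [matDerivation, add_smul, Finset.sum_add_distrib]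

theorem matDerivation_smul (r : ℂ) (A : Matrix (Fin 2) (Fin 2) ℂ) :
    matDerivation (r • A) = r • matDerivation A := by
  apply MvPolynomial.derivation_ext
  intro m
  simp [matDerivation, mul_smul]

theorem matDerivation_lie (A B : Matrix (Fin 2) (Fin 2) ℂ) :
    matDerivation (A * B - B * A) = ⁅matDerivation A, matDerivation B⁆ := by
  apply MvPolynomial.derivation_ext
  intro m
  rw [Derivation.commutator_apply]
  simp only [matDerivation, MvPolynomial.mkDerivation_X, Fin.sum_univ_two, Derivation.map_add,
    Derivation.map_smul, Matrix.sub_apply, Matrix.mul_apply]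
  module

/-- The representation of `𝔰𝔩(2)` on the `(k+1)`-dimensional space of homogeneous polynomials of
degree `k` in two variables (the `k`-th symmetric power of the natural representation), that is, the
irreducible `(k+1)`-dimensional representation. -/
def symPowerRep (k : ℕ) :
    SL2 →ₗ⁅ℂ⁆ Module.End ℂ (MvPolynomial.homogeneousSubmodule (Fin 2) ℂ k) where
  toFun A := (matDerivation A.1).toLinearMap.restrict (matDerivation_mem A.1 k)
  map_add' A B := by
    ext f : 2
    simp [LinearMap.restrict_apply, matDerivation_add]
  map_smul' r A := by
    ext f : 2
    simp [LinearMap.restrict_apply, matDerivation_smul]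
  map_lie' {A B} := by
    ext f : 2
    simp [LinearMap.restrict_apply, LieRing.of_associative_ring_bracket, matDerivation_lie]

theorem sl_trace (A : SL2) : A.1 1 1 = - A.1 0 0 := by
  have h : Matrix.trace A.1 = 0 := A.2
  rw [Matrix.trace_fin_two] at h
  linear_combination h

/-- The infinite-dimensional lowest weight representation of `𝔰𝔩(2)` with lowest weight `δ`, on
`ℂ[z]`: `H = z`, `D = z ∂ + δ`, `C = z ∂² + 2 δ ∂`, so that for `e_j = z^j` one has
`H e_j = e_{j+1}`, `D e_j = (δ + j) e_j`, `C e_j = j (2 δ + j - 1) e_{j-1}`. -/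
def lowestWeightRep (δ : ℂ) : SL2 →ₗ⁅ℂ⁆ Module.End ℂ (Polynomial ℂ) where
  toFun A :=
    (2 * A.1 0 0) • (LinearMap.mulLeft ℂ Polynomial.X ∘ₗ Polynomial.derivative + δ • LinearMap.id)
      + A.1 0 1 • LinearMap.mulLeft ℂ Polynomial.X
      - A.1 1 0 • (LinearMap.mulLeft ℂ Polynomial.X ∘ₗ Polynomial.derivative ∘ₗ
          Polynomial.derivative + (2 * δ) • Polynomial.derivative)
  map_add' A B := by
    refine LinearMap.ext fun f => ?_
    simp [Polynomial.smul_eq_C_mul]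
    ring
  map_smul' r A := by
    refine LinearMap.ext fun f => ?_
    simp [Polynomial.smul_eq_C_mul]
    ring
  map_lie' {A B} := by
    have hA := sl_trace A
    have hB := sl_trace B
    rw [LieRing.of_associative_ring_bracket, LieAlgebra.SpecialLinear.sl_bracket]
    refine LinearMap.ext fun f => ?_
    have h2 : (Polynomial.C 2 : Polynomial ℂ) = 2 := rfl
    simp [Matrix.mul_apply, Fin.sum_univ_two, hA, hB, Polynomial.smul_eq_C_mul, h2]
    ring

/-- The `𝔤`-module `M` is isomorphic to the `𝔰𝔩(2)`-module `ρ`, on which all `P_n` act by zero and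
`H, D, C` act as elements of `𝔰𝔩(2)`. -/
def PointedModule.IsoSL2 {l : ℕ} (M : PointedModule l) {W : Type} [AddCommGroup W] [Module ℂ W]
    (ρ : SL2 →ₗ⁅ℂ⁆ Module.End ℂ W) : Prop :=
  ∃ e : M.carrier ≃ₗ[ℂ] W, ∀ (x : CGA l) (v : M.carrier), e (ι l x • v) = ρ (toSL2 l x) (e v)

end

end

noncomputable section

open CGA

attribute [local instance 100] LieRing.ofAssociativeRing

/-! ## Generalities on `U(𝔤)` -/

namespace CGA

variable {l : ℕ}

/-! No PBW theorem is needed. Each iterated quotient is known through a universal property: it maps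
to every pointed module whose vector has the right weight and satisfies the relations imposed
(`vermaQuot_spec`, `vermaQuotZero_spec`, `vermaQuotFin_spec`, all resting on `exists_verma_lift`).
Moving generators past `H` yields an explicit spanning family, so the quotient is not too large; a
concrete model satisfying the same relations shows that it is not too small.

For `p ≠ 0` the relations make `P_{l-a} u₀` a multiple of `P_{l-1}^a u₀`, so the vectors `H^k
P_{l-1}^m u₀` span (`span_H_pow_P_pow`). The model lives on `ℂ[t][h]`: `H` multiplies by `h`, `C`
acts as `∂_t` on polynomials in `t` alone, and `P_n` is a polynomial in `t` and `∂_h` whose part of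
order `0` in `∂_h` is `p * binom(2l-n, l) * t^(l-n)`. The spanning family goes to a rescaled
monomial basis, hence the comparison map is an isomorphism (`bijective_of_span_of_basis`). The model
is irreducible because `P_{l+1}` lowers the degree in `h` by exactly one and `C` then differentiates
in `t`, so every nonzero vector can be brought to a nonzero constant (`exists_model`).

For `p = 0` the vectors `H^j u₀` span, and `C H^{j+1} u₀ = (j+1)(2δ+j) H^j u₀`. If `H^{j+1} u₀ = 0`
whenever `2δ+j = 0`, a suitable power of `C` sends any nonzero combination to a nonzero multiple of
`u₀` (`isSimpleModule_of_span_H_pow`). The models are `ℂ[z]` in the generic case and binary forms of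
degree `k` in the finite-dimensional one; in the latter, simplicity makes the comparison map
injective, and the powers of `H` applied to `x₁^k` make it surjective. -/

/-- An enveloping algebra is generated by the Lie algebra. -/
theorem adjoin_range_ι {L : Type*} [LieRing L] [LieAlgebra ℂ L] :
    Algebra.adjoin ℂ (Set.range (UniversalEnvelopingAlgebra.ι ℂ : L → _)) = ⊤ := by
  set S := Algebra.adjoin ℂ
    (Set.range (UniversalEnvelopingAlgebra.ι ℂ : L → UniversalEnvelopingAlgebra ℂ L)) with hS
  let f : L →ₗ⁅ℂ⁆ S :=
    { toFun x := ⟨UniversalEnvelopingAlgebra.ι ℂ x, Algebra.subset_adjoin ⟨x, rfl⟩⟩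
      map_add' x y := by ext; simp
      map_smul' r x := by ext; simp
      map_lie' {x y} := by
        ext
        simp [LieRing.of_associative_ring_bracket] }
  -- By uniqueness in the universal property, lifting into `S` and including back is the identity,
  -- so every element already lies in `S`.
  have h : S.val.comp (UniversalEnvelopingAlgebra.lift ℂ f) = AlgHom.id ℂ _ := by
    ext x
    simp [f]
  rw [eq_top_iff]
  intro x _
  have := DFunLike.congr_fun h x
  simp only [AlgHom.comp_apply, AlgHom.id_apply] at this
  rw [← this]
  exact Subtype.property _

/-- An induction principle for enveloping algebras. -/
theorem enveloping_induction {L : Type*} [LieRing L] [LieAlgebra ℂ L]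
    {motive : UniversalEnvelopingAlgebra ℂ L → Prop}
    (hι : ∀ x : L, motive (UniversalEnvelopingAlgebra.ι ℂ x))
    (hc : ∀ r : ℂ, motive (algebraMap ℂ _ r))
    (hadd : ∀ a b, motive a → motive b → motive (a + b))
    (hmul : ∀ a b, motive a → motive b → motive (a * b))
    (u : UniversalEnvelopingAlgebra ℂ L) : motive u := by
  have hu : u ∈ Algebra.adjoin ℂ
      (Set.range (UniversalEnvelopingAlgebra.ι ℂ : L → UniversalEnvelopingAlgebra ℂ L)) := by
    rw [adjoin_range_ι]; trivial
  induction hu using Algebra.adjoin_induction with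
  | mem x hx => obtain ⟨y, rfl⟩ := hx; exact hι y
  | algebraMap r => exact hc r
  | add a b _ _ ha hb => exact hadd a b ha hb
  | mul a b _ _ ha hb => exact hmul a b ha hb

theorem lie_smul_eq {M : Type*} [AddCommGroup M] [Module (U l) M] (x y : CGA l) (v : M) :
    ι l x • ι l y • v = ι l y • ι l x • v + ι l ⁅x, y⁆ • v := by
  rw [ι, ι, ι, LieHom.map_lie, LieRing.of_associative_ring_bracket, sub_smul, mul_smul, mul_smul]
  abel

section
variable {M : Type*} [AddCommGroup M] [Module (U l) M] [Module ℂ M] [IsScalarTower ℂ (U l) M]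

theorem smul_comm_U (c : ℂ) (u : U l) (v : M) : u • c • v = c • u • v := by
  rw [← algebraMap_smul (U l) c v, ← algebraMap_smul (U l) c (u • v), ← mul_smul, ← mul_smul,
    Algebra.commutes]

theorem ι_smul_smul (c : ℂ) (x : CGA l) (v : M) : ι l (c • x) • v = c • ι l x • v := by
  rw [ι, map_smul, smul_assoc]

/-- The action of an element of `U(𝔤)` as a complex linear map. -/
def actHom (u : U l) : M →ₗ[ℂ] M where
  toFun v := u • v
  map_add' := smul_add u
  map_smul' c v := smul_comm_U c u v

theorem map_complex_smul {M' : Type*} [AddCommGroup M'] [Module (U l) M'] [Module ℂ M']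
    [IsScalarTower ℂ (U l) M'] (f : M →ₗ[U l] M') (c : ℂ) (v : M) : f (c • v) = c • f v := by
  rw [← algebraMap_smul (U l) c v, ← algebraMap_smul (U l) c (f v), map_smul]

/-- The generators span `𝔤`. -/
theorem mem_of_generators (S : Submodule ℂ (CGA l)) (hD : D l ∈ S) (hH : H l ∈ S) (hC : C l ∈ S)
    (hP : ∀ n ≤ 2 * l, P l n ∈ S) (x : CGA l) : x ∈ S := by
  rw [eq_sum l x]
  refine add_mem (add_mem (add_mem (S.smul_mem _ hD) (S.smul_mem _ hH)) (S.smul_mem _ hC)) ?_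
  exact Submodule.sum_mem _ fun n _ => S.smul_mem _ (hP n (by omega))

/-- If the generators map a complex subspace `W` to a complex subspace `S`, all of `𝔤` does. -/
theorem ι_smul_mem_of_generators (S W : Submodule ℂ M)
    (hD : ∀ w ∈ W, ι l (D l) • w ∈ S) (hH : ∀ w ∈ W, ι l (H l) • w ∈ S)
    (hC : ∀ w ∈ W, ι l (C l) • w ∈ S) (hP : ∀ n ≤ 2 * l, ∀ w ∈ W, ι l (P l n) • w ∈ S)
    (x : CGA l) : ∀ w ∈ W, ι l x • w ∈ S := by
  intro w hw
  let f : CGA l →ₗ[ℂ] M :=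
    { toFun x := ι l x • w
      map_add' x y := by rw [ι, map_add, add_smul]
      map_smul' c x := ι_smul_smul c x w }
  exact mem_of_generators (S.comap f) (hD w hw) (hH w hw) (hC w hw) (fun n hn => hP n hn w hw) x

/-- A complex subspace stable under `𝔤` and containing a generator is everything. -/
theorem eq_top_of_stable (S : Submodule ℂ M) {v : M} (hv : Submodule.span (U l) {v} = ⊤)
    (hvS : v ∈ S) (hS : ∀ x : CGA l, ∀ w ∈ S, ι l x • w ∈ S) : S = ⊤ := by
  have key : ∀ u : U l, ∀ w ∈ S, u • w ∈ S := by
    intro u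
    induction u using enveloping_induction with
    | hι x => exact hS x
    | hc r => intro w hw; rw [algebraMap_smul]; exact S.smul_mem _ hw
    | hadd a b ha hb => intro w hw; rw [add_smul]; exact add_mem (ha w hw) (hb w hw)
    | hmul a b ha hb => intro w hw; rw [mul_smul]; exact ha _ (hb w hw)
  rw [eq_top_iff]
  intro w _
  have : w ∈ Submodule.span (U l) {v} := by rw [hv]; trivial
  obtain ⟨u, rfl⟩ := Submodule.mem_span_singleton.1 this
  exact key u v hvS

/-- If `W` is stable under `D`, `C` and all `P_n` and contains a generator, then the `H^k W` span
the module. -/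
theorem span_H_pow_eq_top (W : Submodule ℂ M) {v : M} (hv : Submodule.span (U l) {v} = ⊤)
    (hvW : v ∈ W) (hD : ∀ w ∈ W, ι l (D l) • w ∈ W) (hC : ∀ w ∈ W, ι l (C l) • w ∈ W)
    (hP : ∀ n ≤ 2 * l, ∀ w ∈ W, ι l (P l n) • w ∈ W) :
    Submodule.span ℂ {x : M | ∃ k : ℕ, ∃ w ∈ W, x = ι l (H l) ^ k • w} = ⊤ := by
  set S := Submodule.span ℂ {x : M | ∃ k : ℕ, ∃ w ∈ W, x = ι l (H l) ^ k • w} with hS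
  have hWS : W ≤ S := fun w hw => Submodule.subset_span ⟨0, w, hw, by simp⟩
  have hHS : ∀ s ∈ S, ι l (H l) • s ∈ S := by
    intro s hs
    have : S ≤ S.comap (actHom (ι l (H l))) := by
      rw [hS, Submodule.span_le]
      rintro _ ⟨k, w, hw, rfl⟩
      refine Submodule.subset_span ⟨k + 1, w, hw, ?_⟩
      rw [actHom, LinearMap.coe_mk, AddHom.coe_mk, pow_succ', mul_smul]
    exact this hs
  -- Since `x` stays quantified in the induction, the commutator `⁅x, H⁆` is covered by the
  -- hypothesis and need not be computed.
  have key : ∀ k : ℕ, ∀ w ∈ W, ∀ x : CGA l, ι l x • ι l (H l) ^ k • w ∈ S := by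
    intro k w hw
    induction k with
    | zero =>
      intro x
      rw [pow_zero, one_smul]
      exact ι_smul_mem_of_generators S W (fun w hw => hWS (hD w hw)) (fun w hw => hHS _ (hWS hw))
        (fun w hw => hWS (hC w hw)) (fun n hn w hw => hWS (hP n hn w hw)) x w hw
    | succ k ih =>
      intro x
      rw [pow_succ', mul_smul, lie_smul_eq]
      exact add_mem (hHS _ (ih x)) (ih _)
  refine eq_top_of_stable S hv (hWS hvW) fun x => ?_
  have : S ≤ S.comap (actHom (ι l x)) := by
    rw [hS, Submodule.span_le]
    rintro _ ⟨k, w, hw, rfl⟩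
    exact key k w hw x
  exact fun s hs => this hs

end

/-! ### Representations from operators -/

/-- Operators satisfying the defining relations give a representation of `𝔤`. -/
theorem exists_lieHom {E : Type*} [Ring E] [Algebra ℂ E] (d h c : E) (P' : ℕ → E)
    (hdh : d * h - h * d = h) (hdc : d * c - c * d = -c) (hch : c * h - h * c = (2 : ℂ) • d)
    (hPP : ∀ m n, P' m * P' n = P' n * P' m)
    (hdP : ∀ n ≤ 2 * l, d * P' n - P' n * d = ((l : ℂ) - n) • P' n)
    (hhP0 : h * P' 0 - P' 0 * h = 0)
    (hhP : ∀ n, n + 1 ≤ 2 * l → h * P' (n + 1) - P' (n + 1) * h = (-((n : ℂ) + 1)) • P' n)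
    (hcP : ∀ n ≤ 2 * l, c * P' n - P' n * c = ((2 * l : ℂ) - n) • P' (n + 1)) :
    ∃ ρ : CGA l →ₗ⁅ℂ⁆ E, ρ (D l) = d ∧ ρ (H l) = h ∧ ρ (C l) = c ∧
      ∀ n ≤ 2 * l, ρ (P l n) = P' n := by
  let f : CGA l →ₗ[ℂ] E :=
    { toFun x := x.d • d + x.h • h + x.c • c + ∑ n : Fin (2 * l + 1), x.a n • P' n
      map_add' x y := by
        simp only [add_d, add_h, add_c, add_a, Pi.add_apply, add_smul, Finset.sum_add_distrib]
        abel
      map_smul' r x := by simp [mul_smul, Finset.smul_sum] }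
  have fD : f (D l) = d := by simp [f, D]
  have fH : f (H l) = h := by simp [f, H]
  have fC : f (C l) = c := by simp [f, C]
  have fP : ∀ n ≤ 2 * l, f (P l n) = P' n := by
    intro n hn
    simp only [f, P, LinearMap.coe_mk, AddHom.coe_mk, zero_smul, zero_add, ite_smul, one_smul]
    rw [Finset.sum_eq_single (⟨n, by omega⟩ : Fin (2 * l + 1))]
    · simp
    · intro b _ hb; rw [if_neg]; simpa [Fin.ext_iff] using hb
    · simp
  have hfCP : ∀ n ≤ 2 * l, f ⁅C l, P l n⁆ = c * P' n - P' n * c := by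
    intro n hn
    rw [lie_C_P l n hn, map_smul, hcP n hn]
    -- At `n = 2 l` the coefficient `2 l - n` is zero, so the value of `P'` at the out-of-range
    -- index `2 l + 1` is irrelevant.
    rcases hn.eq_or_lt with rfl | h
    · simp
    · rw [fP _ (by omega)]
  have hfHP : ∀ n ≤ 2 * l, f ⁅H l, P l n⁆ = h * P' n - P' n * h := by
    intro n hn
    cases n with
    | zero => rw [lie_H_P_zero, map_zero, hhP0]
    | succ n => rw [lie_H_P_succ l n hn, map_smul, hhP n hn, fP _ (by omega)]
  have hfDP : ∀ n ≤ 2 * l, f ⁅D l, P l n⁆ = d * P' n - P' n * d := by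
    intro n hn
    rw [lie_D_P l n hn, map_smul, hdP n hn, fP _ (by omega)]
  have hfDH : f ⁅D l, H l⁆ = d * h - h * d := by rw [lie_D_H, fH, hdh]
  have hfDC : f ⁅D l, C l⁆ = d * c - c * d := by rw [lie_D_C, map_neg, fC, hdc]
  have hfCH : f ⁅C l, H l⁆ = c * h - h * c := by rw [lie_C_H, map_smul, fD, hch]
  -- `T x y` is the failure of `f` to preserve the bracket. It is linear in `y` and skew, so its
  -- vanishing on pairs of generators spreads first to `y` and then, by skewness, to `x`.
  let T (x : CGA l) : CGA l →ₗ[ℂ] E :=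
    { toFun y := f ⁅x, y⁆ - (f x * f y - f y * f x)
      map_add' y z := by simp only [lie_add, map_add, mul_add, add_mul]; abel
      map_smul' r y := by
        simp only [lie_smul, map_smul, mul_smul_comm, smul_mul_assoc, RingHom.id_apply, smul_sub] }
  have hT : ∀ x y, T x y = f ⁅x, y⁆ - (f x * f y - f y * f x) := fun _ _ => rfl
  have hTs : ∀ x y, T x y = - T y x := by
    intro x y
    rw [hT, hT, ← lie_skew, map_neg]; abel
  have gen : ∀ x : CGA l, T x (D l) = 0 → T x (H l) = 0 → T x (C l) = 0 →
      (∀ n ≤ 2 * l, T x (P l n) = 0) → ∀ y, T x y = 0 := fun x h1 h2 h3 h4 y =>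
    mem_of_generators (LinearMap.ker (T x)) h1 h2 h3 h4 y
  have self : ∀ x, T x x = 0 := by intro x; simp [hT]
  have tDH : T (D l) (H l) = 0 := by rw [hT, hfDH, fD, fH, sub_self]
  have tDC : T (D l) (C l) = 0 := by rw [hT, hfDC, fD, fC, sub_self]
  have tCH : T (C l) (H l) = 0 := by rw [hT, hfCH, fC, fH, sub_self]
  have tDP : ∀ n ≤ 2 * l, T (D l) (P l n) = 0 := fun n hn => by
    rw [hT, hfDP n hn, fD, fP n hn, sub_self]
  have tHP : ∀ n ≤ 2 * l, T (H l) (P l n) = 0 := fun n hn => by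
    rw [hT, hfHP n hn, fH, fP n hn, sub_self]
  have tCP : ∀ n ≤ 2 * l, T (C l) (P l n) = 0 := fun n hn => by
    rw [hT, hfCP n hn, fC, fP n hn, sub_self]
  have tPP : ∀ m ≤ 2 * l, ∀ n ≤ 2 * l, T (P l m) (P l n) = 0 := fun m hm n hn => by
    rw [hT, lie_P_P, map_zero, fP m hm, fP n hn, hPP, sub_self, sub_self]
  have tD := gen (D l) (self _) tDH tDC tDP
  have tH := gen (H l) (by rw [hTs, tDH, neg_zero]) (self _) (by rw [hTs, tCH, neg_zero]) tHP
  have tC := gen (C l) (by rw [hTs, tDC, neg_zero]) tCH (self _) tCP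
  have tP : ∀ n ≤ 2 * l, ∀ y, T (P l n) y = 0 := fun n hn =>
    gen (P l n) (by rw [hTs, tD, neg_zero]) (by rw [hTs, tH, neg_zero]) (by rw [hTs, tC, neg_zero])
      fun m hm => tPP n hn m hm
  have all : ∀ x y, T x y = 0 := fun x =>
    gen x (by rw [hTs, tD, neg_zero]) (by rw [hTs, tH, neg_zero]) (by rw [hTs, tC, neg_zero])
      fun n hn => by rw [hTs, tP n hn, neg_zero]
  refine ⟨{ f with map_lie' := fun {x y} => ?_ }, fD, fH, fC, fP⟩
  have := all x y
  rw [hT, sub_eq_zero] at this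
  rw [LieRing.of_associative_ring_bracket]
  exact this

end CGA

/-! ## Pointed modules -/

namespace PointedModule

variable {l : ℕ}

/-- A representation and a vector give a pointed module. -/
theorem exists_of_rep {W : Type} [AddCommGroup W] [Module ℂ W] (ρ : CGA l →ₗ⁅ℂ⁆ Module.End ℂ W)
    (w : W) : ∃ (M : PointedModule l) (e : W ≃ₗ[ℂ] M.carrier), M.u₀ = e w ∧
      ∀ (x : CGA l) (f : W), ι l x • e f = e (ρ x f) := by
  let _ : Module (U l) W := Module.compHom W (UniversalEnvelopingAlgebra.lift ℂ ρ).toRingHom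
  refine ⟨{ carrier := W, u₀ := w, isScalarTower := ⟨fun c u v => ?_⟩ }, LinearEquiv.refl ℂ W, rfl,
    fun x f => ?_⟩
  · change UniversalEnvelopingAlgebra.lift ℂ ρ (c • u) v =
      c • UniversalEnvelopingAlgebra.lift ℂ ρ u v
    rw [map_smul]; rfl
  · change UniversalEnvelopingAlgebra.lift ℂ ρ (ι l x) f = _
    rw [UniversalEnvelopingAlgebra.lift_ι_apply]; rfl

/-- The weight conditions on the chosen vector of a lowest weight module. -/
def HasWeight (M : PointedModule l) (δ p : ℂ) : Prop :=
  ι l (D l) • M.u₀ = δ • M.u₀ ∧ ι l (P l l) • M.u₀ = p • M.u₀ ∧ ι l (C l) • M.u₀ = 0 ∧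
    ∀ n, l < n → n ≤ 2 * l → ι l (P l n) • M.u₀ = 0

/-- The chosen vector generates the module. -/
def Generated (M : PointedModule l) : Prop := Submodule.span (U l) {M.u₀} = ⊤

theorem HasWeight.map {M M' : PointedModule l} {δ p : ℂ} (h : M.HasWeight δ p)
    (f : M.carrier →ₗ[U l] M'.carrier) (hf : f M.u₀ = M'.u₀) : M'.HasWeight δ p := by
  obtain ⟨h1, h2, h3, h4⟩ := h
  refine ⟨?_, ?_, ?_, fun n hn hn' => ?_⟩
  · rw [← hf, ← map_smul, h1, map_complex_smul]
  · rw [← hf, ← map_smul, h2, map_complex_smul]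
  · rw [← hf, ← map_smul, h3, map_zero]
  · rw [← hf, ← map_smul, h4 n hn hn', map_zero]

theorem Generated.map {M M' : PointedModule l} (h : M.Generated)
    (f : M.carrier →ₗ[U l] M'.carrier) (hf : f M.u₀ = M'.u₀) (hs : Function.Surjective f) :
    M'.Generated := by
  rw [Generated, ← hf, ← Set.image_singleton, ← Submodule.map_span, show _ = ⊤ from h,
    Submodule.map_top, LinearMap.range_eq_top.2 hs]

/-- The projection onto a quotient. -/
def quotMk (M : PointedModule l) (v : M.carrier) : M.carrier →ₗ[U l] (M.quot v).carrier :=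
  Submodule.mkQ _

theorem quotMk_surjective (M : PointedModule l) (v : M.carrier) :
    Function.Surjective (M.quotMk v) := Submodule.mkQ_surjective _

theorem quotMk_self (M : PointedModule l) (v : M.carrier) : M.quotMk v v = 0 :=
  (Submodule.Quotient.mk_eq_zero _).2 (Submodule.mem_span_singleton_self v)

theorem exists_quot_lift (M : PointedModule l) (v : M.carrier) {M' : PointedModule l}
    (f : M.carrier →ₗ[U l] M'.carrier) (hf : f M.u₀ = M'.u₀) (hv : f v = 0) :
    ∃ g : (M.quot v).carrier →ₗ[U l] M'.carrier, g (M.quot v).u₀ = M'.u₀ :=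
  ⟨Submodule.liftQ _ f (by rw [Submodule.span_le]; rintro x rfl; exact hv), hf⟩

/-- `HasWeight` only tests a spanning set of `gMinus`; linearity does the rest. -/
theorem HasWeight.isLowestWeight {M : PointedModule l} {δ p : ℂ} (h : M.HasWeight δ p)
    (hg : M.Generated) (h0 : M.u₀ ≠ 0) : M.IsLowestWeight δ p := by
  obtain ⟨h1, h2, h3, h4⟩ := h
  refine ⟨h0, hg, h1, h2, fun x hx => ?_⟩
  induction hx using Submodule.span_induction with
  | mem x hx =>
    rcases hx with rfl | ⟨n, hn, hn', rfl⟩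
    · exact h3
    · exact h4 n hn hn'
  | zero => simp [ι]
  | add x y _ _ hx hy => rw [ι, map_add, add_smul, hx, hy, add_zero]
  | smul r x _ hx => rw [ι_smul_smul, hx, smul_zero]

/-- A generated module in which every nonzero vector generates `u₀` is simple. -/
theorem isSimpleModule_of_forall {M : PointedModule l} (hg : M.Generated) (h0 : M.u₀ ≠ 0)
    (h : ∀ v : M.carrier, v ≠ 0 → ∃ u : U l, u • v = M.u₀) : IsSimpleModule (U l) M.carrier := by
  rw [isSimpleModule_iff_toSpanSingleton_surjective]
  refine ⟨⟨⟨_, _, h0⟩⟩, fun v hv => ?_⟩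
  rw [← LinearMap.range_eq_top, LinearMap.range_toSpanSingleton, eq_top_iff, ← show _ = ⊤ from hg,
    Submodule.span_le]
  rintro _ rfl
  obtain ⟨u, hu⟩ := h v hv
  rw [← hu]
  exact Submodule.smul_mem _ _ (Submodule.mem_span_singleton_self v)

end PointedModule

/-! ### The Verma module -/

section verma
variable {l : ℕ} {δ p : ℂ}
open PointedModule
open scoped TensorProduct

theorem verma_generated : (verma l δ p).Generated := by
  rw [Generated, eq_top_iff]
  rintro x -
  obtain ⟨t, rfl⟩ := Submodule.Quotient.mk_surjective _ x
  induction t using TensorProduct.induction_on with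
  | zero => exact zero_mem _
  | add a b ha hb => exact add_mem ha hb
  | tmul u z =>
    refine Submodule.mem_span_singleton.2 ⟨z • u, ?_⟩
    change Submodule.Quotient.mk ((z • u) • ((1 : U l) ⊗ₜ[ℂ] (1 : ℂ))) = _
    rw [TensorProduct.smul_tmul', smul_eq_mul, mul_one, TensorProduct.smul_tmul, smul_eq_mul,
      mul_one]

/-- This is the defining relation of `vermaRel` at `u = 1`, `z = 1`, with `b` the image of `x` in
the enveloping algebra of `borel l`. -/
theorem verma_borel_smul (x : borel l) :
    ι l x • (verma l δ p).u₀ = (δ * x.1.d + p * coef x.1.a l) • (verma l δ p).u₀ := by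
  change Submodule.Quotient.mk (ι l x • ((1 : U l) ⊗ₜ[ℂ] (1 : ℂ))) =
    Submodule.Quotient.mk ((δ * x.1.d + p * coef x.1.a l) • ((1 : U l) ⊗ₜ[ℂ] (1 : ℂ)))
  rw [Submodule.Quotient.eq]
  refine Submodule.subset_span ⟨1, UniversalEnvelopingAlgebra.ι ℂ x, 1, ?_⟩
  rw [incl, character, UniversalEnvelopingAlgebra.lift_ι_apply,
    UniversalEnvelopingAlgebra.lift_ι_apply, TensorProduct.smul_tmul', ← TensorProduct.tmul_smul]
  simp [lieCharacter]

theorem verma_hasWeight : (verma l δ p).HasWeight δ p := by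
  have hD : D l ∈ borel l := ⟨rfl, fun m _ => coef_zero l m⟩
  have hC : C l ∈ borel l := ⟨rfl, fun m _ => coef_zero l m⟩
  have hP : ∀ n : ℕ, l ≤ n → n ≤ 2 * l → P l n ∈ borel l := fun n h h' => by
    refine ⟨rfl, fun m hm => ?_⟩
    rw [coef_P l n h', if_neg (by omega)]
  refine ⟨?_, ?_, ?_, fun n hn hn' => ?_⟩
  · simpa [D, coef_zero] using verma_borel_smul (δ := δ) (p := p) ⟨D l, hD⟩
  · have := verma_borel_smul (δ := δ) (p := p) ⟨P l l, hP l le_rfl (by omega)⟩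
    simp only [coef_P l l (by omega : l ≤ 2 * l)] at this
    simpa [P] using this
  · simpa [C, coef_zero] using verma_borel_smul (δ := δ) (p := p) ⟨C l, hC⟩
  · have := verma_borel_smul (δ := δ) (p := p) ⟨P l n, hP n hn.le hn'⟩
    simp only [coef_P l n hn'] at this
    rw [if_neg (by omega)] at this
    simpa [P] using this

/-- Expanding `x` in the basis, only the `D` and `P_l` terms survive. This passes from conditions on
generators to the whole character of `borel l`, as the universal property requires. -/
theorem borel_smul_of_hasWeight {M : PointedModule l} (h : M.HasWeight δ p) (x : borel l) :
    ι l x • M.u₀ = (δ * x.1.d + p * coef x.1.a l) • M.u₀ := by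
  obtain ⟨h1, h2, h3, h4⟩ := h
  obtain ⟨x, hx, hx'⟩ := x
  have key : ∀ n : Fin (2 * l + 1), ι l (x.a n • P l n) • M.u₀ =
      if (n : ℕ) = l then (p * coef x.a l) • M.u₀ else 0 := by
    intro n
    rw [ι_smul_smul]
    rcases lt_trichotomy (n : ℕ) l with h | h | h
    · rw [if_neg h.ne, ← coef_natCast x.a n, hx' _ (by exact_mod_cast h), zero_smul]
    · rw [if_pos h, h, h2, ← coef_natCast x.a n, h, smul_smul, mul_comm]
    · rw [if_neg h.ne', h4 n h (by omega), smul_zero]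
  have hsum : ι l (∑ n : Fin (2 * l + 1), x.a n • P l n) • M.u₀ = (p * coef x.a l) • M.u₀ := by
    rw [ι, map_sum, Finset.sum_smul, Finset.sum_congr rfl fun n _ => key n,
      Finset.sum_eq_single (⟨l, by omega⟩ : Fin (2 * l + 1))]
    · simp
    · intro b _ hb; rw [if_neg]; simpa [Fin.ext_iff] using hb
    · simp
  simp only
  conv_lhs => rw [eq_sum l x, hx, zero_smul, add_zero]
  rw [ι, map_add, map_add, add_smul, add_smul, hsum, ι_smul_smul, ι_smul_smul, h1, h3,
    smul_zero, add_zero, smul_smul, ← add_smul, mul_comm δ]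

/-- The universal property of the Verma module. -/
theorem exists_verma_lift {M : PointedModule l} (h : M.HasWeight δ p) :
    ∃ f : (verma l δ p).carrier →ₗ[U l] M.carrier, f (verma l δ p).u₀ = M.u₀ := by
  -- The identity extends from the Lie algebra to products because each factor acts on `u₀` by a
  -- scalar, and scalars can be pulled out in either order.
  have key : ∀ b : UBorel l, incl l b • M.u₀ = character l δ p b • M.u₀ := by
    intro b
    induction b using enveloping_induction with
    | hι x =>
      rw [incl, character, UniversalEnvelopingAlgebra.lift_ι_apply,
        UniversalEnvelopingAlgebra.lift_ι_apply]
      exact borel_smul_of_hasWeight h x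
    | hc r => rw [AlgHom.commutes, AlgHom.commutes, algebraMap_smul]; rfl
    | hadd a b ha hb => rw [map_add, map_add, add_smul, add_smul, ha, hb]
    | hmul a b ha hb => rw [map_mul, map_mul, mul_smul, hb, smul_comm_U, ha, smul_smul, mul_comm]
  let f : U l ⊗[ℂ] ℂ →ₗ[U l] M.carrier :=
    LinearMap.toSpanSingleton (U l) M.carrier M.u₀ ∘ₗ
      (TensorProduct.AlgebraTensorModule.rid ℂ (U l) (U l)).toLinearMap
  have hf : ∀ (u : U l) (z : ℂ), f (u ⊗ₜ z) = z • u • M.u₀ := by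
    intro u z
    simp [f]
  refine ⟨Submodule.liftQ _ f ?_, ?_⟩
  · rw [vermaRel, Submodule.span_le]
    rintro _ ⟨u, b, z, rfl⟩
    rw [SetLike.mem_coe, LinearMap.mem_ker, map_sub, hf, hf, mul_smul, key, smul_comm_U, smul_smul,
      mul_comm, sub_self]
  · change f (1 ⊗ₜ 1) = _
    rw [hf, one_smul, one_smul]

end verma

/-! ### The iterated quotients -/

section iterated
variable {l : ℕ} {δ p : ℂ}
open PointedModule

/-- The vector is a fixed element of `U l` applied to `u₀`, so any pointed homomorphism carries it
along. -/
theorem map_singularVector {M M' : PointedModule l} (f : M.carrier →ₗ[U l] M'.carrier)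
    (hf : f M.u₀ = M'.u₀) (n : ℕ) : f (singularVector p n M) = singularVector p n M' := by
  simp only [singularVector, map_sub, map_complex_smul, map_smul, hf]

/-- `vermaQuot l δ p n` is universal among the modules of weight `(δ, p)` in which the singular
vectors of index at most `n` vanish. -/
theorem vermaQuot_spec (n : ℕ) :
    (vermaQuot l δ p n).Generated ∧ (vermaQuot l δ p n).HasWeight δ p ∧
    (∀ i, 2 ≤ i → i ≤ n → singularVector p i (vermaQuot l δ p n) = 0) ∧
    ∀ M : PointedModule l, M.HasWeight δ p →
      (∀ i, 2 ≤ i → i ≤ n → singularVector p i M = 0) →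
      ∃ f : (vermaQuot l δ p n).carrier →ₗ[U l] M.carrier, f (vermaQuot l δ p n).u₀ = M.u₀ := by
  -- The recursion has two base cases, since indices `0` and `1` both denote the Verma module.
  induction n using Nat.twoStepInduction with
  | zero => exact ⟨verma_generated, verma_hasWeight, fun i h h' => by omega,
      fun M hM _ => exists_verma_lift hM⟩
  | one => exact ⟨verma_generated, verma_hasWeight, fun i h h' => by omega,
      fun M hM _ => exists_verma_lift hM⟩
  | more n _ ih =>
    obtain ⟨hg, hw, hs, hu⟩ := ih
    let V := vermaQuot l δ p (n + 1)
    let π : V.carrier →ₗ[U l] (vermaQuot l δ p (n + 2)).carrier :=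
      V.quotMk (singularVector p (n + 2) V)
    have hπ : π V.u₀ = (vermaQuot l δ p (n + 2)).u₀ := rfl
    refine ⟨hg.map π hπ (quotMk_surjective _ _), hw.map π hπ, fun i h h' => ?_, fun M hM hM' => ?_⟩
    · rw [← map_singularVector π hπ]
      rcases h'.eq_or_lt with rfl | h'
      · exact quotMk_self _ _
      · rw [hs i h (by omega), map_zero]
    · obtain ⟨f, hf⟩ := hu M hM fun i h h' => hM' i h (by omega)
      refine exists_quot_lift V _ f hf ?_
      rw [map_singularVector f hf]
      exact hM' _ (by omega) le_rfl

/-- `vermaQuotZero l δ n` is universal among the modules of weight `(δ, 0)` in which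
`P_{l-1} u₀, …, P_{l-n} u₀` vanish. -/
theorem vermaQuotZero_spec (n : ℕ) :
    (vermaQuotZero l δ n).Generated ∧ (vermaQuotZero l δ n).HasWeight δ 0 ∧
    (∀ i, 1 ≤ i → i ≤ n → ι l (P l (l - i)) • (vermaQuotZero l δ n).u₀ = 0) ∧
    ∀ M : PointedModule l, M.HasWeight δ 0 →
      (∀ i, 1 ≤ i → i ≤ n → ι l (P l (l - i)) • M.u₀ = 0) →
      ∃ f : (vermaQuotZero l δ n).carrier →ₗ[U l] M.carrier,
        f (vermaQuotZero l δ n).u₀ = M.u₀ := by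
  induction n with
  | zero => exact ⟨verma_generated, verma_hasWeight, fun i h h' => by omega,
      fun M hM _ => exists_verma_lift hM⟩
  | succ n ih =>
    obtain ⟨hg, hw, hs, hu⟩ := ih
    let V := vermaQuotZero l δ n
    let π : V.carrier →ₗ[U l] (vermaQuotZero l δ (n + 1)).carrier :=
      V.quotMk (ι l (P l (l - (n + 1))) • V.u₀)
    have hπ : π V.u₀ = (vermaQuotZero l δ (n + 1)).u₀ := rfl
    refine ⟨hg.map π hπ (quotMk_surjective _ _), hw.map π hπ, fun i h h' => ?_, fun M hM hM' => ?_⟩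
    · rw [← hπ, ← map_smul]
      rcases h'.eq_or_lt with rfl | h'
      · exact quotMk_self _ _
      · rw [hs i h (by omega), map_zero]
    · obtain ⟨f, hf⟩ := hu M hM fun i h h' => hM' i h (by omega)
      refine exists_quot_lift V _ f hf ?_
      rw [map_smul, hf]
      exact hM' _ (by omega) le_rfl

end iterated

/-! ### Spanning families in lowest weight modules -/

namespace PointedModule

variable {l : ℕ} {δ p : ℂ} {M : PointedModule l}

theorem P_smul_P_pow (n m k : ℕ) (v : M.carrier) :
    ι l (P l n) • ι l (P l k) ^ m • v = ι l (P l k) ^ m • ι l (P l n) • v := by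
  induction m with
  | zero => simp
  | succ m ih => rw [pow_succ', mul_smul, mul_smul, lie_smul_eq, lie_P_P, ih,
    show ι l (0 : CGA l) = 0 from map_zero _, zero_smul, add_zero]

/-- If `P_{l-a} u₀` is a multiple of `P_{l-1}^a u₀` for all `a`, then the `H^k P_{l-1}^m u₀` span.
-/
theorem span_H_pow_P_pow (hl : 1 ≤ l) (hg : M.Generated) (hw : M.HasWeight δ p)
    (hP : ∀ a, 2 ≤ a → a ≤ l → ∃ c : ℂ, ι l (P l (l - a)) • M.u₀ = c • ι l (P l (l - 1))
    ^ a • M.u₀) :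
    Submodule.span ℂ (Set.range fun km : ℕ × ℕ =>
      (ι l (H l) ^ km.1 * ι l (P l (l - 1)) ^ km.2) • M.u₀) = ⊤ := by
  obtain ⟨h1, h2, h3, h4⟩ := hw
  set q := ι l (P l (l - 1)) with hq
  set W : Submodule ℂ M.carrier := Submodule.span ℂ (Set.range fun m : ℕ => q ^ m • M.u₀) with hW
  have hmem : ∀ m, q ^ m • M.u₀ ∈ W := fun m => Submodule.subset_span ⟨m, rfl⟩
  have stable : ∀ u : U l, (∀ m, u • q ^ m • M.u₀ ∈ W) → ∀ w ∈ W, u • w ∈ W := by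
    intro u hu w hw
    have : W ≤ W.comap (actHom u) := by
      rw [hW, Submodule.span_le]
      rintro _ ⟨m, rfl⟩
      exact hu m
    exact this hw
  have hqW : ∀ m, ∀ w ∈ W, q ^ m • w ∈ W := fun m => stable _ fun m' => by
    rw [← mul_smul, ← pow_add]; exact hmem _
  have hqW1 : ∀ w ∈ W, q • w ∈ W := fun w hw => by
    have := hqW 1 w hw
    rwa [pow_one] at this
  -- As the `P_n` commute, only `P_n u₀` matters: a multiple of a power of `P_{l-1}` on `u₀` for `n
  -- < l`, the scalar `p` for `n = l`, zero beyond.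
  have hPW : ∀ n ≤ 2 * l, ∀ w ∈ W, ι l (P l n) • w ∈ W := by
    refine fun n hn => stable _ fun m => ?_
    rw [P_smul_P_pow]
    apply hqW
    rcases lt_trichotomy n l with h | rfl | h
    · obtain ⟨a, ha, hn'⟩ : ∃ a, a ≤ l ∧ n = l - a := ⟨l - n, by omega, by omega⟩
      rcases (show a = 1 ∨ 2 ≤ a by omega) with rfl | ha'
      · have := hmem 1
        rwa [pow_one, hq, ← hn'] at this
      · obtain ⟨c, hc⟩ := hP a ha' ha
        rw [hn']
        rw [hc]
        exact W.smul_mem _ (hmem _)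
    · rw [h2]; exact W.smul_mem _ (by simpa using hmem 0)
    · rw [h4 n h hn]; exact W.zero_mem
  have hDW : ∀ w ∈ W, ι l (D l) • w ∈ W := by
    refine stable _ fun m => ?_
    induction m with
    | zero => rw [pow_zero, one_smul, h1]; exact W.smul_mem _ (by simpa using hmem 0)
    | succ m ih =>
      rw [pow_succ', mul_smul, hq, lie_smul_eq, lie_D_P l _ (by omega), ι_smul_smul]
      exact add_mem (hqW1 _ ih) (W.smul_mem _ (hPW _ (by omega) _ (hmem m)))
  have hCW : ∀ w ∈ W, ι l (C l) • w ∈ W := by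
    refine stable _ fun m => ?_
    induction m with
    | zero => rw [pow_zero, one_smul, h3]; exact W.zero_mem
    | succ m ih =>
      rw [pow_succ', mul_smul, hq, lie_smul_eq, lie_C_P l _ (by omega), ι_smul_smul]
      exact add_mem (hqW1 _ ih) (W.smul_mem _ (hPW _ (by omega) _ (hmem m)))
  have top := span_H_pow_eq_top W hg (by simpa using hmem 0) hDW hCW hPW
  rw [eq_top_iff, ← top, Submodule.span_le]
  rintro _ ⟨k, w, hw, rfl⟩
  have : W ≤ (Submodule.span ℂ (Set.range fun km : ℕ × ℕ =>
      (ι l (H l) ^ km.1 * q ^ km.2) • M.u₀)).comap (actHom (ι l (H l) ^ k)) := by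
    rw [hW, Submodule.span_le]
    rintro _ ⟨m, rfl⟩
    refine Submodule.subset_span ⟨(k, m), ?_⟩
    simp only [mul_smul]
    rfl
  exact this hw

/-! ### Modules on which the `P_n` act trivially -/

theorem D_smul_H_pow (hw : M.HasWeight δ p) (j : ℕ) :
    ι l (D l) • ι l (H l) ^ j • M.u₀ = (δ + j) • ι l (H l) ^ j • M.u₀ := by
  induction j with
  | zero => simpa using hw.1
  | succ j ih =>
    rw [pow_succ', mul_smul, lie_smul_eq, lie_D_H, ih, smul_comm_U,
      show δ + ((j + 1 : ℕ) : ℂ) = (δ + j) + 1 by push_cast; ring, add_smul (δ + (j : ℂ)), one_smul]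

/-- Each passage of `C` across an `H` contributes `2 D`, and `∑_{i ≤ j} 2(δ+i) = (j+1)(2δ+j)`. -/
theorem C_smul_H_pow_succ (hw : M.HasWeight δ p) (j : ℕ) :
    ι l (C l) • ι l (H l) ^ (j + 1) • M.u₀ = (((j : ℂ) + 1) * (2 * δ + j)) • ι l (H l)
      ^ j • M.u₀ := by
  induction j with
  | zero =>
    rw [pow_succ', mul_smul, lie_smul_eq, lie_C_H, ι_smul_smul, D_smul_H_pow hw]
    simp only [pow_zero, one_smul]
    rw [hw.2.2.1, smul_zero, zero_add, smul_smul]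
    push_cast
    congr 1; ring
  | succ j ih =>
    rw [pow_succ', mul_smul, lie_smul_eq, lie_C_H, ι_smul_smul, D_smul_H_pow hw, ih, smul_comm_U,
      ← mul_smul, ← pow_succ', smul_smul, ← add_smul]
    congr 1
    push_cast
    ring

theorem C_pow_smul_H_pow (hw : M.HasWeight δ p) (j : ℕ) :
    ι l (C l) ^ j • ι l (H l) ^ j • M.u₀ =
      (∏ i ∈ Finset.range j, (((i : ℂ) + 1) * (2 * δ + i))) • M.u₀ := by
  induction j with
  | zero => simp
  | succ j ih =>
    rw [pow_succ (ι l (C l)), mul_smul, C_smul_H_pow_succ hw, smul_comm_U, ih, smul_smul,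
      Finset.prod_range_succ, mul_comm]

theorem C_pow_smul_H_pow_of_lt (hw : M.HasWeight δ p) {i j : ℕ} (hij : i < j) :
    ι l (C l) ^ j • ι l (H l) ^ i • M.u₀ = 0 := by
  obtain ⟨k, rfl⟩ : ∃ k, j = k + 1 + i := ⟨j - i - 1, by omega⟩
  rw [pow_add, mul_smul, C_pow_smul_H_pow hw, smul_comm_U, pow_succ, mul_smul, hw.2.2.1, smul_zero,
    smul_zero]

/-- The line through `u₀` is already stable under `D`, `C` and all `P_n`, so `span_H_pow_eq_top`
applies to it. -/
theorem span_H_pow (hg : M.Generated) (hw : M.HasWeight δ p)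
    (hP : ∀ n ≤ 2 * l, ι l (P l n) • M.u₀ = 0) :
    Submodule.span ℂ (Set.range fun j : ℕ => ι l (H l) ^ j • M.u₀) = ⊤ := by
  have := span_H_pow_eq_top (Submodule.span ℂ {M.u₀}) hg (Submodule.mem_span_singleton_self _)
    ?_ ?_ ?_
  · rw [eq_top_iff, ← this, Submodule.span_le]
    rintro _ ⟨k, w, hw, rfl⟩
    obtain ⟨c, rfl⟩ := Submodule.mem_span_singleton.1 hw
    rw [smul_comm_U]
    exact Submodule.smul_mem _ _ (Submodule.subset_span ⟨k, rfl⟩)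
  · intro w hw'
    obtain ⟨c, rfl⟩ := Submodule.mem_span_singleton.1 hw'
    rw [smul_comm_U, hw.1]
    exact Submodule.smul_mem _ _ (Submodule.smul_mem _ _ (Submodule.mem_span_singleton_self _))
  · intro w hw'
    obtain ⟨c, rfl⟩ := Submodule.mem_span_singleton.1 hw'
    rw [smul_comm_U, hw.2.2.1, smul_zero]
    exact zero_mem _
  · intro n hn w hw'
    obtain ⟨c, rfl⟩ := Submodule.mem_span_singleton.1 hw'
    rw [smul_comm_U, hP n hn, smul_zero]
    exact zero_mem _

/-- A vanishing factor `2δ+i` with `i < j` would force `H^{i+1} u₀ = 0`, and hence `H^j u₀ = 0`. -/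
theorem prod_ne_zero_of_H_pow_ne_zero (hH : ∀ j : ℕ, 2 * δ + j = 0 → ι l (H l) ^ (j + 1) • M.u₀ = 0)
    {j : ℕ} (hj : ι l (H l) ^ j • M.u₀ ≠ 0) :
    (∏ i ∈ Finset.range j, (((i : ℂ) + 1) * (2 * δ + i))) ≠ 0 := by
  rw [Finset.prod_ne_zero_iff]
  intro i hi
  rw [Finset.mem_range] at hi
  refine mul_ne_zero (Nat.cast_add_one_ne_zero i) fun h => hj ?_
  rw [show j = j - (i + 1) + (i + 1) by omega, pow_add, mul_smul, hH i h, smul_zero]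

/-- A module spanned by the `H^j u₀` is simple if `H^{j+1} u₀ = 0` whenever `2 δ + j = 0`. -/
theorem isSimpleModule_of_span_H_pow (hg : M.Generated) (hw : M.HasWeight δ p) (h0 : M.u₀ ≠ 0)
    (hspan : Submodule.span ℂ (Set.range fun j : ℕ => ι l (H l) ^ j • M.u₀) = ⊤)
    (hH : ∀ j : ℕ, 2 * δ + j = 0 → ι l (H l) ^ (j + 1) • M.u₀ = 0) :
    IsSimpleModule (U l) M.carrier := by
  have key : ∀ (J : ℕ) (a : ℕ → ℂ), ∑ j ∈ Finset.range J, a j • ι l (H l) ^ j • M.u₀ ≠ 0 →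
      ∃ u : U l, u • ∑ j ∈ Finset.range J, a j • ι l (H l) ^ j • M.u₀ = M.u₀ := by
    intro J a
    induction J with
    | zero => simp
    | succ J ih =>
      rw [Finset.sum_range_succ]
      -- If the top term vanishes as a vector it is dropped; otherwise `C^J` kills all lower terms
      -- and turns the top one into a nonzero multiple of `u₀`.
      by_cases hJ : a J • ι l (H l) ^ J • M.u₀ = 0
      · rw [hJ, add_zero]; exact ih
      · intro _
        rw [smul_eq_zero, not_or] at hJ
        have hne := prod_ne_zero_of_H_pow_ne_zero hH hJ.2
        set c := ∏ i ∈ Finset.range J, (((i : ℂ) + 1) * (2 * δ + i)) with hc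
        refine ⟨((a J * c)⁻¹ : ℂ) • ι l (C l) ^ J, ?_⟩
        rw [smul_assoc, smul_add, Finset.smul_sum, Finset.sum_eq_zero, zero_add, smul_comm_U,
          C_pow_smul_H_pow hw, ← hc, smul_smul, smul_smul, mul_assoc,
            inv_mul_cancel₀ (mul_ne_zero hJ.1 hne),
          one_smul]
        intro i hi
        rw [smul_comm_U, C_pow_smul_H_pow_of_lt hw (Finset.mem_range.1 hi), smul_zero]
  refine isSimpleModule_of_forall hg h0 fun v hv => ?_
  have hv' : v ∈ Submodule.span ℂ (Set.range fun j : ℕ => ι l (H l) ^ j • M.u₀) := by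
    rw [hspan]; trivial
  obtain ⟨a, rfl⟩ := Finsupp.mem_span_range_iff_exists_finsupp.1 hv'
  obtain ⟨J, hJ⟩ := a.support.exists_nat_subset_range
  have : (a.sum fun j c => c • ι l (H l) ^ j • M.u₀) =
      ∑ j ∈ Finset.range J, a j • ι l (H l) ^ j • M.u₀ :=
    Finsupp.sum_of_support_subset _ hJ _ (by simp)
  rw [this] at hv ⊢
  exact key J a hv

end PointedModule

/-- A linear map sending a spanning family to a basis is an isomorphism. -/
theorem bijective_of_span_of_basis {I V W : Type*} [AddCommGroup V] [Module ℂ V] [AddCommGroup W]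
    [Module ℂ W] (f : V →ₗ[ℂ] W) (v : I → V) (b : Module.Basis I ℂ W)
    (hv : Submodule.span ℂ (Set.range v) = ⊤) (h : ∀ i, f (v i) = b i) : Function.Bijective f := by
  have h1 : (b.constr ℂ v) ∘ₗ f = LinearMap.id := by
    apply LinearMap.ext_on_range hv
    intro i
    simp [h]
  have h2 : f ∘ₗ (b.constr ℂ v) = LinearMap.id := b.ext fun i => by simp [h]
  exact ⟨Function.LeftInverse.injective (g := b.constr ℂ v) (DFunLike.congr_fun h1),
    Function.RightInverse.surjective (g := b.constr ℂ v) (DFunLike.congr_fun h2)⟩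

/-! ## The model on `ℂ[t][h]` for `p ≠ 0` -/

namespace GalileiModel

open Polynomial

/-- The coefficientwise derivative `∂_t` on `ℂ[t][h]`. -/
def dt : ℂ[X][X] →ₗ[ℂ] ℂ[X][X] :=
  Polynomial.lsum fun n => (monomial n).restrictScalars ℂ ∘ₗ derivative

theorem dt_monomial (n : ℕ) (a : ℂ[X]) : dt (monomial n a) = monomial n (derivative a) := by
  change (monomial n a).sum _ = _
  rw [sum_monomial_index] <;> simp

theorem dt_C (a : ℂ[X]) : dt (Polynomial.C a) = Polynomial.C (derivative a) := dt_monomial 0 a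

theorem coeff_dt (f : ℂ[X][X]) (n : ℕ) : (dt f).coeff n = derivative (f.coeff n) := by
  induction f using Polynomial.induction_on' with
  | add f g hf hg => simp [hf, hg]
  | monomial m a => rw [dt_monomial, coeff_monomial, coeff_monomial]; split_ifs <;> simp

theorem dt_C_mul (a : ℂ[X]) (f : ℂ[X][X]) :
    dt (Polynomial.C a * f) = Polynomial.C (derivative a) * f + Polynomial.C a * dt f := by
  ext1 n
  simp only [coeff_dt, coeff_C_mul, coeff_add, derivative_mul]

theorem dt_X_mul (f : ℂ[X][X]) : dt (X * f) = X * dt f := by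
  ext1 n
  cases n <;> simp [coeff_dt]

theorem dt_derivative (f : ℂ[X][X]) : dt (derivative f) = derivative (dt f) := by
  ext1 n
  simp only [coeff_dt, coeff_derivative, derivative_mul]
  simp

/-- The operator `π(t, ∂_h)` on `ℂ[t][h]`. -/
def op (π : ℂ[X][X]) : ℂ[X][X] →ₗ[ℂ[X]] ℂ[X][X] := aeval (derivative : Module.End ℂ[X] ℂ[X][X]) π

theorem op_C (a : ℂ[X]) (f : ℂ[X][X]) : op (Polynomial.C a) f = Polynomial.C a * f := by
  rw [op, aeval_C, Module.algebraMap_end_apply, smul_eq_C_mul]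

theorem op_mul (π σ f : ℂ[X][X]) : op (π * σ) f = op π (op σ f) := by
  rw [op, map_mul]; rfl

theorem op_X (f : ℂ[X][X]) : op X f = derivative f := by rw [op, aeval_X]

theorem op_add (π σ f : ℂ[X][X]) : op (π + σ) f = op π f + op σ f := by
  rw [op, map_add]; rfl

theorem op_sub (π σ f : ℂ[X][X]) : op (π - σ) f = op π f - op σ f := by
  rw [op, map_sub]; rfl

theorem op_C_mul (π : ℂ[X][X]) (a : ℂ[X]) (f : ℂ[X][X]) :
    op π (Polynomial.C a * f) = Polynomial.C a * op π f := by
  rw [← smul_eq_C_mul, map_smul, smul_eq_C_mul]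

theorem op_derivative (π f : ℂ[X][X]) : op π (derivative f) = derivative (op π f) := by
  rw [← op_X, ← op_X, ← op_mul, ← op_mul, mul_comm]

/-- `[π(t, ∂_h), h] = (∂_y π)(t, ∂_h)`. -/
theorem op_X_mul (π f : ℂ[X][X]) : op π (X * f) = X * op π f + op (derivative π) f := by
  induction π using Polynomial.induction_on generalizing f with
  | C a => rw [op_C, op_C, derivative_C, op, map_zero, LinearMap.zero_apply]; ring
  | add π σ hπ hσ => rw [op_add, hπ, hσ, derivative_add, op_add, op_add]; ring
  | monomial n a ih =>
    rw [pow_succ, ← mul_assoc]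
    generalize Polynomial.C a * X ^ n = σ at ih ⊢
    rw [op_mul, op_X, derivative_mul, derivative_X, one_mul, map_add, ih, derivative_mul,
      derivative_X, op_add, op_mul, op_mul, op_X, mul_one]
    ring

/-- `[∂_t, π(t, ∂_h)] = (∂_t π)(t, ∂_h)`. -/
theorem dt_op (π f : ℂ[X][X]) : dt (op π f) = op (dt π) f + op π (dt f) := by
  induction π using Polynomial.induction_on generalizing f with
  | C a => rw [op_C, op_C, dt_C_mul, dt_C, op_C]
  | add π σ hπ hσ => rw [op_add, map_add, hπ, hσ, map_add, op_add, op_add]; ring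
  | monomial n a ih =>
    rw [pow_succ, ← mul_assoc]
    generalize Polynomial.C a * X ^ n = σ at ih ⊢
    rw [op_mul, op_X, ih, mul_comm σ X, dt_X_mul, mul_comm X, mul_comm X, op_mul, op_mul, op_X,
      op_X, dt_derivative]

/-! ### Symbols of the `P_n` and their differential identities -/

variable (l : ℕ) (δ p : ℂ)

/-- The element of `ℂ[t]` by which `P_m` acts on the vectors of degree `0` in `h`. -/
def pbar (m : ℕ) : ℂ[X] := monomial (l - m) (p * (Nat.choose (2 * l - m) l : ℂ))

/-- The symbol of `P_n`. -/
def symbol (n : ℕ) : ℂ[X][X] :=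
  ∑ j ∈ Finset.range (n + 1), monomial j ((n.choose j : ℂ) • pbar l p (n - j))

theorem coeff_symbol (n j : ℕ) :
    (symbol l p n).coeff j = (n.choose j : ℂ) • pbar l p (n - j) := by
  rw [symbol, finsetSum_coeff]
  simp only [coeff_monomial]
  rw [Finset.sum_ite_eq']
  split_ifs with h
  · rfl
  · rw [Nat.choose_eq_zero_of_lt (by simpa using h)]; simp

/-- Homogeneity in `t`. For `m > l` the exponent `l - m` is truncated to `0`, but the binomial
coefficient vanishes there. -/
theorem X_mul_derivative_pbar (m : ℕ) (hm : m ≤ 2 * l) :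
    X * derivative (pbar l p m) = ((l : ℂ) - m) • pbar l p m := by
  rw [pbar, derivative_monomial, smul_monomial]
  rcases lt_or_ge m l with h | h
  · rw [X_mul_monomial, show l - m - 1 + 1 = l - m by omega, Nat.cast_sub h.le, smul_eq_mul,
      mul_comm]
  · rcases h.eq_or_lt with rfl | h
    · simp
    · rw [Nat.choose_eq_zero_of_lt (by omega)]; simp

/-- The identity `(l-m) binom(2l-m, l) = (2l-m) binom(2l-m-1, l)`. It is `[C, P_m] = (2l-m) P_{m+1}`
seen in degree `0` in `h`, where `C` acts as `∂_t`, and it dictates the choice of binomials in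
`pbar`. -/
theorem derivative_pbar (hl : 1 ≤ l) (m : ℕ) (hm : m ≤ 2 * l) :
    derivative (pbar l p m) = ((2 * l : ℂ) - m) • pbar l p (m + 1) := by
  rw [pbar, pbar, derivative_monomial, smul_monomial, show l - m - 1 = l - (m + 1) by omega]
  congr 1
  rcases lt_or_ge m l with h | h
  · have h1 := Nat.add_one_mul_choose_eq (2 * l - (m + 1)) (l - m - 1)
    have h2 : 2 * l - (m + 1) = l + (l - m - 1) := by omega
    have h3 : 2 * l - m = l + (l - m) := by omega
    have h4 : (2 * l - (m + 1)).choose (l - m - 1) = (2 * l - (m + 1)).choose l := by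
      rw [h2, Nat.choose_symm_add]
    have h5 : (2 * l - m).choose (l - m) = (2 * l - m).choose l := by
      rw [h3, Nat.choose_symm_add]
    rw [show 2 * l - (m + 1) + 1 = 2 * l - m by omega,
      show l - m - 1 + 1 = l - m by omega, h4, h5] at h1
    have h1' : ((2 * l - m : ℕ) : ℂ) * ((2 * l - (m + 1)).choose l : ℂ) =
      ((2 * l - m).choose l : ℂ) * ((l - m : ℕ) : ℂ) := by exact_mod_cast h1
    rw [Nat.cast_sub hm] at h1'
    push_cast at h1'
    rw [smul_eq_mul]
    linear_combination -p * h1'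
  · rw [Nat.choose_eq_zero_of_lt (show 2 * l - (m + 1) < l by omega), show l - m = 0 by omega]
    simp

/-- The symbols form an Appell sequence in the variable standing for `∂_h`. Through `op_X_mul` this
becomes the bracket of `H` with `P_{n+1}`. -/
theorem derivative_symbol_succ (n : ℕ) :
    derivative (symbol l p (n + 1)) = ((n : ℂ) + 1) • symbol l p n := by
  ext1 j
  rw [coeff_derivative, coeff_symbol, coeff_smul, coeff_symbol, smul_smul, Nat.add_sub_add_right]
  have h : ((n : ℂ) + 1) * n.choose j = (n + 1).choose (j + 1) * ((j : ℂ) + 1) := by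
    exact_mod_cast Nat.add_one_mul_choose_eq n j
  rw [h, mul_smul, smul_mul_assoc, Algebra.smul_def ((j : ℂ) + 1), mul_comm]
  simp

theorem derivative_symbol_zero : derivative (symbol l p 0) = 0 := by
  simp [symbol]

/-- Writing `y` for the symbol of `∂_h`, the commutator of `h ∂_h + t ∂_t` with `π(t, ∂_h)` has
symbol `t ∂_t π - y ∂_y π`; this is therefore `[D, P_n]` at the level of symbols. -/
theorem D_symbol (n : ℕ) (hn : n ≤ 2 * l) :
    Polynomial.C X * dt (symbol l p n) - X * derivative (symbol l p n) =
      ((l : ℂ) - n) • symbol l p n := by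
  ext1 j
  rw [coeff_sub, coeff_C_mul, coeff_dt, coeff_smul, coeff_symbol, derivative_smul, mul_smul_comm,
    X_mul_derivative_pbar l p _ (by omega)]
  have hX : (X * derivative (symbol l p n)).coeff j = (j : ℂ) • (symbol l p n).coeff j := by
    cases j with
    | zero => simp
    | succ j =>
      rw [coeff_X_mul, coeff_derivative, mul_comm, Algebra.smul_def]
      simp
  rw [hX, coeff_symbol]
  rcases le_or_gt j n with h | h
  · rw [Nat.cast_sub h]
    module
  · rw [Nat.choose_eq_zero_of_lt h]
    simp

/-- The commutator of `opC` with `π(t, ∂_h)` has symbol `∂_t π + 2 t y ∂_t π - y² ∂_y π`, so this is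
`[C, P_n]` at the level of symbols. Coefficientwise it reduces to Pascal's rule and `(j+1) binom(n,
j+1) = (n-j) binom(n, j)`. -/
theorem C_symbol (hl : 1 ≤ l) (n : ℕ) (hn : n ≤ 2 * l) :
    dt (symbol l p n) + 2 * (Polynomial.C X * (X * dt (symbol l p n)))
      - X * (X * derivative (symbol l p n)) = ((2 * l : ℂ) - n) • symbol l p (n + 1) := by
  have h2 : (2 : ℂ[X][X]) = Polynomial.C (Polynomial.C 2) := by rw [map_ofNat, map_ofNat]
  ext1 j
  rw [coeff_sub, coeff_add, h2, coeff_C_mul, coeff_C_mul, coeff_dt, coeff_smul, coeff_symbol,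
    coeff_symbol, derivative_smul, derivative_pbar l p hl _ (by omega)]
  cases j with
  | zero => simp
  | succ j =>
    have hX : (X * derivative (symbol l p n)).coeff j = (j : ℂ) • (symbol l p n).coeff j := by
      cases j with
      | zero => simp
      | succ j =>
        rw [coeff_X_mul, coeff_derivative, mul_comm, Algebra.smul_def]
        simp
    rw [coeff_X_mul, coeff_X_mul, hX, coeff_dt, coeff_symbol, derivative_smul, mul_smul_comm,
      X_mul_derivative_pbar l p _ (by omega), ← smul_eq_C_mul]
    rcases lt_or_ge n j with h | h
    · rw [Nat.choose_eq_zero_of_lt h, Nat.choose_eq_zero_of_lt (show n < j + 1 by omega),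
        Nat.choose_eq_zero_of_lt (show n + 1 < j + 1 by omega)]
      simp
    · have hc : ((n.choose (j + 1) : ℕ) : ℂ) * (j + 1) = n.choose j * ((n : ℂ) - j) := by
        have := Nat.choose_succ_right_eq n j
        rw [← Nat.cast_sub h]
        exact_mod_cast this
      have hc' : (((n + 1).choose (j + 1) : ℕ) : ℂ) = n.choose j + n.choose (j + 1) := by
        rw [Nat.choose_succ_succ]; push_cast; rfl
      -- Truncation breaks `n - (j+1) + 1 = n - j` only at `j = n`, where the binomial coefficient
      -- is zero.
      have hs : (n.choose (j + 1) : ℂ) • (((2 * l : ℂ) - ((n - (j + 1) : ℕ) : ℂ)) •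
          pbar l p (n - (j + 1) + 1)) =
          (n.choose (j + 1) * ((2 * l : ℂ) - n + (j + 1))) • pbar l p (n - j) := by
        rcases h.eq_or_lt with rfl | h
        · simp
        · rw [smul_smul, Nat.cast_sub (by omega), show n - (j + 1) + 1 = n - j by omega]
          push_cast
          congr 2; ring
      rw [hs, Nat.cast_sub h, Nat.add_sub_add_right]
      simp only [smul_smul, ← add_smul, ← sub_smul]
      congr 1
      rw [hc']
      linear_combination hc

/-! ### The operators of the model and their commutation relations -/

/-- `D = h ∂_h + t ∂_t + δ`. -/
def opD : Module.End ℂ ℂ[X][X] where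
  toFun f := X * derivative f + Polynomial.C X * dt f + δ • f
  map_add' f g := by simp only [map_add, smul_add]; ring
  map_smul' c f := by
    simp only [map_smul, derivative_smul, smul_add, mul_smul_comm, RingHom.id_apply, smul_smul,
      mul_comm c]

/-- `H = h`. -/
def opH : Module.End ℂ ℂ[X][X] := LinearMap.mulLeft ℂ X

/-- `C = ∂_t + 2 (t ∂_t + δ) ∂_h + h ∂_h²`. -/
def opC : Module.End ℂ ℂ[X][X] where
  toFun f := dt f + (2 : ℂ) • (Polynomial.C X * dt (derivative f) + δ • derivative f) +
    X * derivative (derivative f)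
  map_add' f g := by simp only [map_add, smul_add, mul_add]; abel
  map_smul' c f := by
    simp only [map_smul, derivative_smul, smul_add, mul_smul_comm, RingHom.id_apply, smul_smul,
      mul_comm c, mul_assoc]

/-- The action of `P_n`. -/
def opP (n : ℕ) : Module.End ℂ ℂ[X][X] := (op (symbol l p n)).restrictScalars ℂ

theorem opP_apply (n : ℕ) (f : ℂ[X][X]) : opP l p n f = op (symbol l p n) f := rfl
theorem opH_apply (f : ℂ[X][X]) : opH f = X * f := rfl
theorem opD_apply (f : ℂ[X][X]) :
    opD δ f = X * derivative f + Polynomial.C X * dt f + δ • f := rfl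
theorem opC_apply (f : ℂ[X][X]) :
    opC δ f = dt f + (2 : ℂ) • (Polynomial.C X * dt (derivative f) + δ • derivative f) +
    X * derivative (derivative f) := rfl

theorem op_smul_left (c : ℂ) (π f : ℂ[X][X]) : op (c • π) f = c • op π f := by
  rw [op, ← algebraMap_smul ℂ[X] c π, map_smul, LinearMap.smul_apply, algebraMap_smul]; rfl

theorem op_smul_right (c : ℂ) (π f : ℂ[X][X]) : op π (c • f) = c • op π f :=
  ((op π).restrictScalars ℂ).map_smul c f

/-- The operators `opP` commute, being polynomials in `∂_h` over `ℂ[t]`. The brackets of `D`, `H`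
and `C` with them reduce, via `op_X_mul` and `dt_op`, to the identities between symbols. -/
theorem exists_rep (hl : 1 ≤ l) : ∃ ρ : CGA l →ₗ⁅ℂ⁆ Module.End ℂ ℂ[X][X],
    ρ (D l) = opD δ ∧ ρ (H l) = opH ∧ ρ (CGA.C l) = opC δ ∧ ∀ n ≤ 2 * l, ρ (P l n) = opP l p n := by
  refine exists_lieHom (opD δ) opH (opC δ) (opP l p) ?_ ?_ ?_ ?_ ?_ ?_ ?_ ?_
  · refine LinearMap.ext fun f => ?_
    simp only [LinearMap.sub_apply, Module.End.mul_apply, opH_apply, opD_apply, derivative_mul,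
      derivative_X, dt_X_mul, Algebra.smul_def]
    ring
  · refine LinearMap.ext fun f => ?_
    simp only [LinearMap.sub_apply, LinearMap.neg_apply, Module.End.mul_apply, opC_apply, opD_apply,
      derivative_mul, derivative_C, derivative_X, dt_X_mul, dt_C_mul, map_add, map_smul,
      dt_derivative]
    simp only [Algebra.smul_def, map_ofNat, derivative_one, map_one, map_zero, zero_mul,
      one_mul, zero_add, dt_derivative]
    ring
  · refine LinearMap.ext fun f => ?_
    simp only [LinearMap.sub_apply, LinearMap.smul_apply, Module.End.mul_apply, opC_apply,
      opD_apply, opH_apply, derivative_mul, derivative_X, dt_X_mul, map_add, dt_derivative]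
    simp only [Algebra.smul_def, map_ofNat, derivative_one]
    ring_nf
  · intro m n
    refine LinearMap.ext fun f => ?_
    simp only [Module.End.mul_apply, opP_apply, ← op_mul, mul_comm]
  · intro n hn
    refine LinearMap.ext fun f => ?_
    simp only [LinearMap.sub_apply, LinearMap.smul_apply, Module.End.mul_apply, opD_apply,
      opP_apply]
    rw [← op_smul_left ((l : ℂ) - n), ← D_symbol l p n hn, op_sub, op_mul, op_mul, op_C, op_X,
      map_add, map_add,
      op_X_mul, op_derivative, op_derivative, op_C_mul, dt_op, op_smul_right]
    ring
  · refine LinearMap.ext fun f => ?_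
    simp only [LinearMap.sub_apply, Module.End.mul_apply, opH_apply, opP_apply, op_X_mul,
      derivative_symbol_zero]
    simp [op]
  · intro n hn
    refine LinearMap.ext fun f => ?_
    simp only [LinearMap.sub_apply, LinearMap.smul_apply, Module.End.mul_apply, opH_apply,
      opP_apply, op_X_mul,
      derivative_symbol_succ, op_smul_left, neg_smul]
    ring
  · intro n hn
    refine LinearMap.ext fun f => ?_
    simp only [LinearMap.sub_apply, LinearMap.smul_apply, Module.End.mul_apply, opC_apply,
      opP_apply]
    have h2 : (2 : ℂ[X][X]) = Polynomial.C (Polynomial.C 2) := by rw [map_ofNat, map_ofNat]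
    rw [← op_smul_left ((2 * l : ℂ) - n), ← C_symbol l p hl n hn, op_sub, op_add, op_mul X,
      op_mul X, op_X, op_X,
      h2, op_mul (Polynomial.C _), op_mul (Polynomial.C _), op_C, op_C, op_mul, op_X]
    simp only [map_add, op_smul_right, op_C_mul, op_X_mul, op_derivative, dt_op, dt_derivative]
    simp only [Algebra.smul_def]
    simp
    ring

end GalileiModel

/-! ### Lowering operators and basis of the model -/

namespace GalileiModel

open Polynomial

variable {l : ℕ} {δ p : ℂ}

theorem pbar_of_lt {m : ℕ} (hm : m ≤ 2 * l) (h : l < m) : pbar l p m = 0 := by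
  rw [pbar, Nat.choose_eq_zero_of_lt (by omega)]; simp

theorem pbar_self : pbar l p l = Polynomial.C p := by
  rw [pbar, show 2 * l - l = l by omega, Nat.choose_self, Nat.sub_self]; simp

theorem coeff_op (π f : ℂ[X][X]) (k : ℕ) : (op π f).coeff k =
    ∑ j ∈ Finset.range (π.natDegree + 1),
      π.coeff j * ((k + j).descFactorial j • f.coeff (k + j)) := by
  rw [op, aeval_eq_sum_range, LinearMap.sum_apply, finsetSum_coeff]
  refine Finset.sum_congr rfl fun j _ => ?_
  rw [LinearMap.smul_apply, Module.End.pow_apply, coeff_smul, coeff_iterate_derivative, smul_eq_mul]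

/-- `∂_h` kills constants in `h`, so only the constant term of the symbol acts; for `P_n` this is
`pbar`. -/
theorem op_C_right (π : ℂ[X][X]) (g : ℂ[X]) :
    op π (Polynomial.C g) = Polynomial.C (π.coeff 0 * g) := by
  ext1 k
  rw [coeff_op, Finset.sum_eq_single 0]
  · cases k <;> simp [coeff_C]
  · intro j _ hj
    rw [coeff_C, if_neg (by omega)]; simp
  · simp

theorem opP_C (n : ℕ) (g : ℂ[X]) : opP l p n (Polynomial.C g) = Polynomial.C (pbar l p n * g) := by
  rw [opP_apply, op_C_right, coeff_symbol]; simp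

theorem opC_C (g : ℂ[X]) : opC δ (Polynomial.C g) = Polynomial.C (derivative g) := by
  rw [opC_apply, dt_C]
  simp only [derivative_C, map_zero, smul_zero, mul_zero, add_zero]

theorem opD_C (g : ℂ[X]) : opD δ (Polynomial.C g) = Polynomial.C (X * derivative g + δ • g) := by
  rw [opD_apply, dt_C, derivative_C, mul_zero, zero_add, map_add, map_mul, smul_C]

/-- `P_{l+1}` lowers the degree in `h` by one. -/
theorem opP_succ_coeff {f : ℂ[X][X]} {k : ℕ} (hl : 1 ≤ l) (hf : f.natDegree ≤ k + 1) :
    (opP l p (l + 1) f).natDegree ≤ k ∧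
      (opP l p (l + 1) f).coeff k =
        Polynomial.C (((l : ℂ) + 1) * p * (k + 1)) * f.coeff (k + 1) := by
  -- The symbol of `P_{l+1}` has no constant term and linear coefficient `(l+1) p`; higher powers of
  -- `∂_h` are invisible in the coefficients of index at least `k`.
  have h0 : (symbol l p (l + 1)).coeff 0 = 0 := by
    rw [coeff_symbol, Nat.sub_zero, pbar_of_lt (by omega) (by omega), smul_zero]
  have h1 : (symbol l p (l + 1)).coeff 1 = Polynomial.C (((l : ℂ) + 1) * p) := by
    rw [coeff_symbol, Nat.add_sub_cancel, pbar_self, Nat.choose_one_right, smul_C]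
    simp
  have hc : ∀ m, k ≤ m → (opP l p (l + 1) f).coeff m =
      Polynomial.C (((l : ℂ) + 1) * p * (m + 1)) * f.coeff (m + 1) := by
    intro m hm
    rw [opP_apply, coeff_op]
    have hterm : ∀ j, j ≠ 1 → (symbol l p (l + 1)).coeff j *
        ((m + j).descFactorial j • f.coeff (m + j)) = 0 := by
      intro j hj
      rcases (show j = 0 ∨ 2 ≤ j by omega) with rfl | hj
      · rw [h0, zero_mul]
      · rw [coeff_eq_zero_of_natDegree_lt (p := f) (by omega), smul_zero, mul_zero]
    have hval : (symbol l p (l + 1)).coeff 1 * ((m + 1).descFactorial 1 • f.coeff (m + 1)) =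
        Polynomial.C (((l : ℂ) + 1) * p * (m + 1)) * f.coeff (m + 1) := by
      rw [h1, Nat.descFactorial_one, nsmul_eq_mul, ← mul_assoc, map_mul _ (((l : ℂ) + 1) * p)]
      simp
    rw [Finset.sum_eq_single 1 (fun j _ hj => hterm j hj), hval]
    intro h
    rw [Finset.mem_range, not_lt] at h
    rw [coeff_eq_zero_of_natDegree_lt (by omega), zero_mul]
  refine ⟨natDegree_le_iff_coeff_eq_zero.2 fun m hm => ?_, hc k le_rfl⟩
  rw [hc m hm.le, coeff_eq_zero_of_natDegree_lt (by omega), mul_zero]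

/-- The basis `h^k (c t)^m` of `ℂ[t][h]`. -/
theorem exists_basis {c : ℂ} (hc : c ≠ 0) : ∃ b : Module.Basis (ℕ × ℕ) ℂ ℂ[X][X],
    ∀ k m, b (k, m) = X ^ k * Polynomial.C ((Polynomial.C c * X) ^ m) := by
  -- The tower of monomial bases gives `h^k t^m`; rescaling by the units `c^m` replaces `t` by `c
  -- t`.
  let b := (basisMonomials ℂ).smulTower' (basisMonomials ℂ[X])
  refine ⟨b.unitsSMul fun km => (Units.mk0 c hc) ^ km.2, fun k m => ?_⟩
  rw [Module.Basis.unitsSMul_apply, Module.Basis.smulTower'_apply]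
  simp only [coe_basisMonomials]
  rw [Units.smul_def, Units.val_pow_eq_pow_val, Units.val_mk0, smul_eq_C_mul,
    monomial_one_right_eq_X_pow, monomial_one_right_eq_X_pow, mul_pow, map_mul Polynomial.C,
    Algebra.smul_def, ← map_pow, mul_comm (X ^ k), mul_assoc]
  rfl

/-- Both sides are `(l+1)(l+2)⋯(l+n)`. This is the numerical reason why the singular vectors vanish
in the model. -/
theorem factorial_mul_choose (l n : ℕ) (hn : 1 ≤ n) :
    (n.factorial : ℂ) * ((l + n).choose l : ℂ) =
      ((l : ℂ) + 1) * ∏ i ∈ Finset.Icc 2 n, ((l : ℂ) + i) := by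
  rw [Nat.choose_symm_add, ← Nat.cast_mul, ← Nat.ascFactorial_eq_factorial_mul_choose]
  induction n, hn using Nat.le_induction with
  | base => simp [Nat.ascFactorial]
  | succ n hn ih =>
    rw [Nat.ascFactorial_succ, Nat.cast_mul, ih, Finset.prod_Icc_succ_top (by omega)]
    push_cast
    ring

theorem pbar_sub (hl : 1 ≤ l) {n : ℕ} (hn : n ≤ l) :
    pbar l p (l - n) = Polynomial.C (p * ((l + n).choose l : ℂ)) * X ^ n := by
  rw [pbar, show l - (l - n) = n by omega, show 2 * l - (l - n) = l + n by omega,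
    C_mul_X_pow_eq_monomial]

/-- When the coefficient of `h^(k+1)` is nonzero, `P_{l+1}` multiplies it by `(l+1) p (k+1)`, which
is nonzero because `p ≠ 0`. This drives the descent in the degree in `h`. -/
theorem exists_natDegree_le_lower {f : ℂ[X][X]} {k : ℕ} (hl : 1 ≤ l) (hp : p ≠ 0)
    (hf : f.natDegree ≤ k + 1) : f.natDegree ≤ k ∨
      (opP l p (l + 1) f ≠ 0 ∧ (opP l p (l + 1) f).natDegree ≤ k) := by
  by_cases h : f.coeff (k + 1) = 0
  · left
    rw [natDegree_le_iff_coeff_eq_zero]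
    intro m hm
    rcases (show k + 1 ≤ m by omega).eq_or_lt with rfl | hm
    · exact h
    · exact coeff_eq_zero_of_natDegree_lt (by omega)
  · right
    obtain ⟨h1, h2⟩ := opP_succ_coeff (p := p) hl hf
    refine ⟨fun h0 => ?_, h1⟩
    rw [h0, coeff_zero, eq_comm, mul_eq_zero, or_iff_left h, C_eq_zero] at h2
    exact mul_ne_zero (mul_ne_zero (Nat.cast_add_one_ne_zero l) hp) (Nat.cast_add_one_ne_zero k) h2

end GalileiModel

open GalileiModel PointedModule in
/-- A lowest weight module on `ℂ[t][h]` on which the singular vectors vanish. -/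
theorem exists_model (l : ℕ) (hl : 1 ≤ l) (δ p : ℂ) (hp : p ≠ 0) :
    ∃ M : PointedModule l, M.HasWeight δ p ∧ M.u₀ ≠ 0 ∧
      (∀ n, 2 ≤ n → n ≤ l → singularVector p n M = 0) ∧
      (∀ v : M.carrier, v ≠ 0 → ∃ u : U l, u • v = M.u₀) ∧
      ∃ b : Module.Basis (ℕ × ℕ) ℂ M.carrier, ∀ k m,
        b (k, m) = (ι l (H l) ^ k * ι l (P l (l - 1)) ^ m) • M.u₀ := by
  obtain ⟨ρ, hD, hH, hC, hP⟩ := exists_rep l δ p hl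
  obtain ⟨M, e, hu, he⟩ := exists_of_rep ρ (Polynomial.C (1 : Polynomial ℂ))
  have aD : ∀ g, ι l (D l) • e (.C g) = e (.C (.X * Polynomial.derivative g + δ • g)) := fun g => by
    rw [he, hD, opD_C]
  have aC : ∀ g, ι l (C l) • e (.C g) = e (.C (Polynomial.derivative g)) := fun g => by
    rw [he, hC, opC_C]
  have aP : ∀ n ≤ 2 * l, ∀ g, ι l (P l n) • e (.C g) = e (.C (pbar l p n * g)) := fun n hn g => by
    rw [he, hP n hn, opP_C]
  have hpow : ∀ m, ι l (P l (l - 1)) ^ m • M.u₀ =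
      e (.C ((.C (((l : ℂ) + 1) * p) * .X) ^ m)) := by
    intro m
    induction m with
    | zero => rw [pow_zero, one_smul, pow_zero, hu]
    | succ m ih =>
      rw [pow_succ', mul_smul, ih, aP _ (by omega), pbar_sub hl hl, Nat.choose_succ_self_right,
        pow_one, pow_succ', mul_comm p]
      push_cast
      rfl
  have hHpow : ∀ k f, ι l (H l) ^ k • e f = e (.X ^ k * f) := by
    intro k f
    induction k with
    | zero => rw [pow_zero, one_smul, pow_zero, one_mul]
    | succ k ih => rw [pow_succ', mul_smul, ih, he, hH, opH_apply, pow_succ', mul_assoc]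
  have hsmul : ∀ (c : ℂ) (g : Polynomial ℂ), c • e (.C g) = e (.C (.C c * g)) := fun c g => by
    rw [← map_smul, Polynomial.smul_C, Polynomial.smul_eq_C_mul]
  refine ⟨M, ⟨?_, ?_, ?_, fun n hn hn' => ?_⟩, ?_, ?_, ?_, ?_⟩
  · rw [hu, aD, Polynomial.derivative_one, mul_zero, zero_add, hsmul, Polynomial.smul_eq_C_mul]
  · rw [hu, aP l (by omega), pbar_self, hsmul]
  · rw [hu, aC, Polynomial.derivative_one, map_zero, map_zero]
  · rw [hu, aP n hn', pbar_of_lt hn' hn, zero_mul, map_zero, map_zero]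
  · rw [hu, Ne, LinearEquiv.map_eq_zero_iff]
    simp
  · intro n hn hn'
    -- On the constant `1`, `P_{l-n}` gives `p * binom(l+n, l) * t^n` and `P_{l-1}^n` gives `((l+1)
    -- p t)^n`; only an equality of scalars remains.
    rw [singularVector, hpow, hu, aP _ (by omega), hsmul, hsmul, ← map_sub, ← map_sub,
      LinearEquiv.map_eq_zero_iff, Polynomial.C_eq_zero, sub_eq_zero, pbar_sub hl hn', mul_one,
      mul_pow, ← mul_assoc, ← mul_assoc, ← map_pow, ← map_mul, ← map_mul]
    congr 2
    obtain ⟨n, rfl⟩ : ∃ k, n = k + 1 := ⟨n - 1, by omega⟩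
    rw [Nat.add_sub_cancel, mul_pow]
    linear_combination (p ^ (n + 1) * ((l : ℂ) + 1) ^ n) * factorial_mul_choose l (n + 1) (by omega)
  -- On polynomials in `t`, `C` is the derivative, so iterating it reaches a nonzero constant.
  · have hconst : ∀ m (g : Polynomial ℂ), g.natDegree ≤ m → g ≠ 0 →
        ∃ u : U l, u • e (.C g) = M.u₀ := by
      intro m
      induction m with
      | zero =>
        intro g hg hg0
        rw [Polynomial.eq_C_of_natDegree_le_zero hg] at hg0 ⊢
        rw [Ne, Polynomial.C_eq_zero] at hg0
        refine ⟨algebraMap ℂ (U l) (g.coeff 0)⁻¹, ?_⟩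
        rw [algebraMap_smul, hsmul, ← map_mul, inv_mul_cancel₀ hg0, hu, map_one]
      | succ m ih =>
        intro g hg hg0
        rcases hg.lt_or_eq with hg | hg
        · exact ih g (by omega) hg0
        · obtain ⟨u, hu'⟩ := ih (Polynomial.derivative g)
            ((Polynomial.natDegree_derivative_le g).trans (by omega)) fun h0 => by
              have := Polynomial.derivative_eq_zero.1 h0
              omega
          exact ⟨u * ι l (C l), by rw [mul_smul, aC, hu']⟩
    -- Descent in the degree in `h` by `P_{l+1}`, until only a polynomial in `t` is left.
    have hall : ∀ k (f : Polynomial (Polynomial ℂ)), f.natDegree ≤ k → f ≠ 0 →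
        ∃ u : U l, u • e f = M.u₀ := by
      intro k
      induction k with
      | zero =>
        intro f hf hf0
        rw [Polynomial.eq_C_of_natDegree_le_zero hf] at hf0 ⊢
        exact hconst _ _ le_rfl fun h => hf0 (by rw [h, map_zero])
      | succ k ih =>
        intro f hf hf0
        rcases exists_natDegree_le_lower hl hp hf with h | ⟨h1, h2⟩
        · exact ih f h hf0
        · obtain ⟨u, hu'⟩ := ih _ h2 h1
          exact ⟨u * ι l (P l (l + 1)), by rw [mul_smul, he, hP _ (by omega), hu']⟩
    intro v hv
    obtain ⟨f, rfl⟩ := e.surjective v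
    exact hall _ f le_rfl fun h => hv (by rw [h, map_zero])
  · obtain ⟨b, hb⟩ :=
      exists_basis (c := ((l : ℂ) + 1) * p) (mul_ne_zero (Nat.cast_add_one_ne_zero l) hp)
    refine ⟨b.map e, fun k m => ?_⟩
    rw [mul_smul, hpow, hHpow, Module.Basis.map_apply, hb]

open PointedModule

/-! ### The case `p ≠ 0` -/

section nonzero
variable {l : ℕ} {δ p : ℂ}

theorem smul_u₀_eq_of_singularVector_eq_zero {M : PointedModule l} (hp : p ≠ 0) {a : ℕ}
    (h : singularVector p a M = 0) :
    ι l (P l (l - a)) • M.u₀ = ((∏ i ∈ Finset.Icc 2 a, ((l : ℂ) + i)) /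
      ((a.factorial : ℂ) * p ^ (a - 1) * ((l : ℂ) + 1) ^ (a - 1))) •
        (ι l (P l (l - 1)) ^ a) • M.u₀ := by
  have hne : (a.factorial : ℂ) * p ^ (a - 1) * ((l : ℂ) + 1) ^ (a - 1) ≠ 0 :=
    mul_ne_zero (mul_ne_zero (Nat.cast_ne_zero.2 a.factorial_ne_zero) (pow_ne_zero _ hp))
      (pow_ne_zero _ (Nat.cast_add_one_ne_zero l))
  rw [singularVector, sub_eq_zero] at h
  rw [div_eq_inv_mul, mul_smul, ← h, smul_smul, inv_mul_cancel₀ hne, one_smul]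

theorem not_finiteDimensional_of_basis {I V : Type*} [Infinite I] [AddCommGroup V] [Module ℂ V]
    (b : Module.Basis I ℂ V) : ¬ FiniteDimensional ℂ V := fun _ =>
  not_finite_iff_infinite.2 ‹Infinite I› (Module.Finite.finite_basis b)

/-- The map to the model supplied by the universal property sends a spanning family to a basis, so
it is an isomorphism; the basis and irreducibility are then pulled back. The case `l = 1` is
included. -/
theorem vermaQuot_structure (hl : 1 ≤ l) (hp : p ≠ 0) :
    (vermaQuot l δ p l).IsIrreducibleLowestWeight δ p ∧
    ∃ b : Module.Basis (ℕ × ℕ) ℂ (vermaQuot l δ p l).carrier, ∀ k m : ℕ,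
      b (k, m) = (ι l (H l) ^ k * ι l (P l (l - 1)) ^ m) • (vermaQuot l δ p l).u₀ := by
  obtain ⟨hg, hw, hs, hu⟩ := vermaQuot_spec (l := l) (δ := δ) (p := p) l
  obtain ⟨M, hMw, hM0, hMs, hMi, b, hb⟩ := exists_model l hl δ p hp
  obtain ⟨f, hf⟩ := hu M hMw hMs
  have hspan := span_H_pow_P_pow hl hg hw fun a h h' =>
    ⟨_, smul_u₀_eq_of_singularVector_eq_zero hp (hs a h h')⟩
  let f' : (vermaQuot l δ p l).carrier →ₗ[ℂ] M.carrier :=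
    { toFun := f, map_add' := map_add f, map_smul' := map_complex_smul f }
  have hbij : Function.Bijective f' := bijective_of_span_of_basis f' _ b hspan fun km => by
    rw [← Prod.mk.eta (p := km), hb, ← hf]
    exact map_smul f _ _
  have h0 : (vermaQuot l δ p l).u₀ ≠ 0 := fun h => hM0 (by rw [← hf, h, map_zero])
  refine ⟨⟨hw.isLowestWeight hg h0, isSimpleModule_of_forall hg h0 fun v hv => ?_⟩,
    b.map (LinearEquiv.ofBijective f' hbij).symm, fun k m => ?_⟩
  · obtain ⟨u, hu⟩ := hMi (f v) fun h => hv (hbij.1 (h.trans (map_zero f).symm))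
    exact ⟨u, hbij.1 (show f (u • v) = f _ by rw [map_smul, hu, hf])⟩
  · rw [Module.Basis.map_apply, LinearEquiv.symm_apply_eq, hb, ← hf]
    exact (map_smul f _ _).symm

end nonzero

/-! ### The case `p = 0` -/

section zero
variable {l : ℕ} {δ : ℂ}

theorem toSL2_P (n : ℕ) : toSL2 l (P l n) = 0 := by
  apply Subtype.ext
  ext i j
  fin_cases i <;> fin_cases j <;> simp [toSL2, P]

theorem toSL2_D : (toSL2 l (D l)).1 = !![1 / 2, 0; 0, -1 / 2] := by simp [toSL2, D]
theorem toSL2_H : (toSL2 l (H l)).1 = !![0, 1; 0, 0] := by simp [toSL2, H]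
theorem toSL2_C : (toSL2 l (C l)).1 = !![0, 0; -1, 0] := by simp [toSL2, C]

theorem P_smul_vermaQuotZero_u₀ (n : ℕ) (hn : n ≤ 2 * l) :
    ι l (P l n) • (vermaQuotZero l δ l).u₀ = 0 := by
  obtain ⟨-, hw, hs, -⟩ := vermaQuotZero_spec (l := l) (δ := δ) l
  rcases lt_trichotomy n l with h | rfl | h
  · have := hs (l - n) (by omega) (by omega)
    rwa [show l - (l - n) = n by omega] at this
  · rw [hw.2.1, zero_smul]
  · exact hw.2.2.2 n h hn

theorem lowestWeightRep_D (f : Polynomial ℂ) : lowestWeightRep δ (toSL2 l (D l)) f =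
    Polynomial.X * Polynomial.derivative f + δ • f := by
  simp [lowestWeightRep, toSL2_D]

theorem lowestWeightRep_H (f : Polynomial ℂ) : lowestWeightRep δ (toSL2 l (H l)) f =
    Polynomial.X * f := by
  simp [lowestWeightRep, toSL2_H]

theorem lowestWeightRep_C (f : Polynomial ℂ) : lowestWeightRep δ (toSL2 l (C l)) f =
    Polynomial.X * Polynomial.derivative (Polynomial.derivative f) +
      (2 * δ) • Polynomial.derivative f := by
  simp [lowestWeightRep, toSL2_C, add_comm]

/-- In the model `ℂ[z]`, `H` is multiplication by `z`, so the spanning family `H^j u₀` goes to the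
monomial basis. Under `hδ` the condition for simplicity is vacuous. -/
theorem vermaQuotZero_structure (hδ : ∀ k : ℕ, 2 * δ + k ≠ 0) :
    (vermaQuotZero l δ l).IsIrreducibleLowestWeight δ 0 ∧
    (vermaQuotZero l δ l).IsoSL2 (lowestWeightRep δ) ∧
    ¬ FiniteDimensional ℂ (vermaQuotZero l δ l).carrier := by
  obtain ⟨hg, hw, hs, hu⟩ := vermaQuotZero_spec (l := l) (δ := δ) l
  obtain ⟨M, e, hM0, he⟩ := exists_of_rep ((lowestWeightRep δ).comp (toSL2 l)) (1 : Polynomial ℂ)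
  have hPM : ∀ n, ι l (P l n) • M.u₀ = 0 := fun n => by
    rw [hM0, he, LieHom.comp_apply, toSL2_P, map_zero, LinearMap.zero_apply, map_zero]
  have hMw : M.HasWeight δ 0 := by
    refine ⟨?_, ?_, ?_, fun n _ _ => hPM n⟩
    · rw [hM0, he, LieHom.comp_apply, lowestWeightRep_D, Polynomial.derivative_one, mul_zero,
        zero_add, map_smul]
    · rw [hPM, zero_smul]
    · rw [hM0, he, LieHom.comp_apply, lowestWeightRep_C, Polynomial.derivative_one, map_zero,
        mul_zero, smul_zero, add_zero, map_zero]
  obtain ⟨f, hf⟩ := hu M hMw fun i _ _ => hPM _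
  have hpow : ∀ j, ι l (H l) ^ j • M.u₀ = e (.X ^ j) := by
    intro j
    induction j with
    | zero => rw [pow_zero, one_smul, pow_zero, hM0]
    | succ j ih =>
      rw [pow_succ', mul_smul, ih, he, LieHom.comp_apply, lowestWeightRep_H, pow_succ']
  let f' : (vermaQuotZero l δ l).carrier →ₗ[ℂ] M.carrier :=
    { toFun := f, map_add' := map_add f, map_smul' := map_complex_smul f }
  have hspan := span_H_pow hg hw P_smul_vermaQuotZero_u₀
  let b := (Polynomial.basisMonomials ℂ).map e
  have hbij : Function.Bijective f' := bijective_of_span_of_basis f' _ b hspan fun j => by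
    change f _ = _
    rw [map_smul, hf, hpow, Module.Basis.map_apply, Polynomial.coe_basisMonomials,
      ← Polynomial.monomial_one_right_eq_X_pow]
  have hne : M.u₀ ≠ 0 := by
    rw [hM0, Ne, LinearEquiv.map_eq_zero_iff]
    exact one_ne_zero
  have h0 : (vermaQuotZero l δ l).u₀ ≠ 0 := fun h => hne (by rw [← hf, h, map_zero])
  let E := LinearEquiv.ofBijective f' hbij
  refine ⟨⟨hw.isLowestWeight hg h0, isSimpleModule_of_span_H_pow hg hw h0 hspan fun j hj =>
    absurd hj (hδ j)⟩, ⟨E.trans e.symm, fun x v => ?_⟩,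
    not_finiteDimensional_of_basis (b.map E.symm)⟩
  rw [LinearEquiv.trans_apply, LinearEquiv.symm_apply_eq, LinearEquiv.trans_apply]
  obtain ⟨g, hg⟩ := e.surjective (E v)
  rw [← hg, LinearEquiv.symm_apply_apply]
  refine ((map_smul f (ι l x) v).trans ?_).trans (he x g)
  exact congrArg _ hg.symm

/-! ### The finite-dimensional case -/

open MvPolynomial in
theorem matDerivation_X_pow_mul (A : Matrix (Fin 2) (Fin 2) ℂ) (i j : ℕ) :
    matDerivation A (X 0 ^ i * X 1 ^ j) =
      (i : ℂ) • (X 0 ^ (i - 1) * X 1 ^ j * (A 0 0 • X 0 + A 1 0 • X 1)) +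
      (j : ℂ) • (X 0 ^ i * X 1 ^ (j - 1) * (A 0 1 • X 0 + A 1 1 • X 1)) := by
  rw [Derivation.leibniz, Derivation.leibniz_pow, Derivation.leibniz_pow]
  simp only [matDerivation, mkDerivation_X, Fin.sum_univ_two, smul_eq_mul,
    Algebra.smul_def, map_natCast, eq_natCast]
  ring

open MvPolynomial in
/-- The vector `x₁^k`. -/
def symLowest (k : ℕ) : homogeneousSubmodule (Fin 2) ℂ k :=
  ⟨X 1 ^ k, by simpa using (isHomogeneous_X ℂ (1 : Fin 2)).pow k⟩

theorem symPowerRep_val (k : ℕ) (A : SL2) (f : MvPolynomial.homogeneousSubmodule (Fin 2) ℂ k) :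
    (symPowerRep k A f).1 = matDerivation A.1 f.1 := rfl

open MvPolynomial in
-- `H` acts on binary forms as `x₀ ∂/∂x₁`.
theorem H_pow_symLowest (k : ℕ) {j : ℕ} (hj : j ≤ k) :
    (((symPowerRep k (toSL2 l (H l))) ^ j) (symLowest k)).1 =
      (k.descFactorial j : ℂ) • (X 0 ^ j * X 1 ^ (k - j)) := by
  induction j with
  | zero => simp [symLowest]
  | succ j ih =>
    rw [pow_succ', Module.End.mul_apply, symPowerRep_val, ih (by omega), Derivation.map_smul,
      matDerivation_X_pow_mul, toSL2_H, Nat.descFactorial_succ, Nat.sub_add_eq]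
    simp [smul_smul, mul_comm (k.descFactorial j : ℂ), pow_succ, mul_right_comm]

theorem H_pow_succ_symLowest (k : ℕ) :
    ((symPowerRep k (toSL2 l (H l))) ^ (k + 1)) (symLowest k) = 0 := by
  apply Subtype.ext
  rw [pow_succ', Module.End.mul_apply, symPowerRep_val, H_pow_symLowest k le_rfl, Nat.sub_self,
    Derivation.map_smul, matDerivation_X_pow_mul, toSL2_H]
  simp

open MvPolynomial in
-- For `j ≤ k`, `H^j x₁^k` is a nonzero multiple of `x₀^j x₁^(k-j)`, and these monomials span the
-- forms of degree `k`.
theorem span_symPower (k : ℕ) : Submodule.span ℂ (Set.range fun j : ℕ =>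
    ((symPowerRep k (toSL2 l (H l))) ^ j) (symLowest k)) = ⊤ := by
  set S := Submodule.span ℂ (Set.range fun j : ℕ =>
    ((symPowerRep k (toSL2 l (H l))) ^ j) (symLowest k)) with hS
  have hmon : ∀ j ≤ k, (X 0 ^ j * X 1 ^ (k - j) : MvPolynomial (Fin 2) ℂ) ∈
      S.map (Submodule.subtype _) := by
    intro j hj
    refine ⟨(k.descFactorial j : ℂ)⁻¹ • ((symPowerRep k (toSL2 l (H l))) ^ j) (symLowest k),
      S.smul_mem _ (Submodule.subset_span ⟨j, rfl⟩), ?_⟩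
    rw [Submodule.subtype_apply, Submodule.coe_smul, H_pow_symLowest k hj, smul_smul,
      inv_mul_cancel₀, one_smul]
    rw [Nat.cast_ne_zero, Ne, Nat.descFactorial_eq_zero_iff_lt]
    omega
  rw [eq_top_iff]
  rintro ⟨f, hf⟩ -
  have hfS : f ∈ S.map (Submodule.subtype _) := by
    rw [f.as_sum]
    refine Submodule.sum_mem _ fun d hd => ?_
    have hdeg : d 0 + d 1 = k := by
      have := hf (mem_support_iff.1 hd)
      rw [Finsupp.weight_apply, Finsupp.sum_fintype _ _ (by simp), Fin.sum_univ_two] at this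
      simpa using this
    have := hmon (d 0) (by omega)
    rw [show k - d 0 = d 1 by omega] at this
    convert Submodule.smul_mem _ (coeff d f) this using 1
    rw [monomial_eq, Finsupp.prod_fintype _ _ (by simp), Fin.prod_univ_two, smul_eq_C_mul]
  obtain ⟨g, hg, hgf⟩ := hfS
  have : g = ⟨f, hf⟩ := Subtype.ext hgf
  rwa [← this]

theorem vermaQuotFin_spec (k : ℕ) :
    (vermaQuotFin l δ k).Generated ∧ (vermaQuotFin l δ k).HasWeight δ 0 ∧
    (∀ n ≤ 2 * l, ι l (P l n) • (vermaQuotFin l δ k).u₀ = 0) ∧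
    ι l (H l) ^ (k + 1) • (vermaQuotFin l δ k).u₀ = 0 ∧
    ∀ M : PointedModule l, M.HasWeight δ 0 → (∀ n, ι l (P l n) • M.u₀ = 0) →
      ι l (H l) ^ (k + 1) • M.u₀ = 0 →
      ∃ f : (vermaQuotFin l δ k).carrier →ₗ[U l] M.carrier, f (vermaQuotFin l δ k).u₀ = M.u₀ := by
  obtain ⟨hg, hw, hs, hu⟩ := vermaQuotZero_spec (l := l) (δ := δ) l
  let V := vermaQuotZero l δ l
  let π : V.carrier →ₗ[U l] (vermaQuotFin l δ k).carrier := V.quotMk (ι l (H l) ^ (k + 1) • V.u₀)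
  have hπ : π V.u₀ = (vermaQuotFin l δ k).u₀ := rfl
  refine ⟨hg.map π hπ (quotMk_surjective _ _), hw.map π hπ, fun n hn => ?_, ?_,
    fun M hM hP hH => ?_⟩
  · rw [← hπ, ← map_smul, P_smul_vermaQuotZero_u₀ n hn, map_zero]
  · rw [← hπ, ← map_smul]
    exact quotMk_self _ _
  · obtain ⟨f, hf⟩ := hu M hM fun i _ _ => hP _
    refine exists_quot_lift V _ f hf ?_
    rw [map_smul, hf, hH]

/-- Here simplicity of the quotient comes before the comparison with the model, and injectivity is
deduced from it. The dimension is read off from an eigenbasis for `D`. -/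
theorem vermaQuotFin_structure {k : ℕ} (hk : 2 * δ + k = 0) :
    (vermaQuotFin l δ k).IsIrreducibleLowestWeight δ 0 ∧
    (vermaQuotFin l δ k).IsoSL2 (symPowerRep k) ∧
    FiniteDimensional ℂ (vermaQuotFin l δ k).carrier ∧
    Module.finrank ℂ (vermaQuotFin l δ k).carrier = k + 1 := by
  obtain ⟨hg, hw, hs, hH, hu⟩ := vermaQuotFin_spec (l := l) (δ := δ) k
  obtain ⟨M, e, hM0, he⟩ := exists_of_rep ((symPowerRep k).comp (toSL2 l)) (symLowest k)
  -- This is the `D`-weight of `x₁^k`, as `D` has eigenvalue `-1/2` on `x₁`.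
  have hδ : δ = -(k / 2 : ℂ) := by linear_combination hk / 2
  have hPM : ∀ n, ι l (P l n) • M.u₀ = 0 := fun n => by
    rw [hM0, he, LieHom.comp_apply, toSL2_P, map_zero, LinearMap.zero_apply, map_zero]
  have hact : ∀ A : Matrix (Fin 2) (Fin 2) ℂ, matDerivation A (symLowest k).1 =
      (k : ℂ) • (.X 1 ^ (k - 1) * (A 0 1 • .X 0 + A 1 1 • .X 1)) := fun A => by
    simpa [symLowest] using matDerivation_X_pow_mul A 0 k
  have hMw : M.HasWeight δ 0 := by
    refine ⟨?_, ?_, ?_, fun n _ _ => hPM n⟩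
    · rw [hM0, he, LieHom.comp_apply, ← map_smul]
      congr 1
      apply Subtype.ext
      rw [symPowerRep_val, hact, toSL2_D, Submodule.coe_smul, hδ]
      cases k with
      | zero => simp
      | succ k =>
        simp only [Matrix.of_apply, Matrix.cons_val', Matrix.cons_val_zero, Matrix.cons_val_one,
          Matrix.cons_val_fin_one, zero_smul, zero_add, mul_smul_comm, symLowest, smul_smul,
          Nat.add_sub_cancel, ← pow_succ]
        congr 1
        ring
    · rw [hPM, zero_smul]
    · rw [hM0, he, LieHom.comp_apply]
      convert map_zero e
      apply Subtype.ext
      rw [symPowerRep_val, hact, toSL2_C]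
      simp
  have hpow : ∀ j, ι l (H l) ^ j • M.u₀ = e (((symPowerRep k (toSL2 l (H l))) ^ j) (symLowest k))
    := by
    intro j
    induction j with
    | zero => rw [pow_zero, one_smul, pow_zero, hM0, Module.End.one_apply]
    | succ j ih =>
      rw [pow_succ', mul_smul, ih, he, LieHom.comp_apply, pow_succ', Module.End.mul_apply]
  obtain ⟨f, hf⟩ := hu M hMw hPM (by rw [hpow, H_pow_succ_symLowest, map_zero])
  have hne : M.u₀ ≠ 0 := by
    rw [hM0, Ne, LinearEquiv.map_eq_zero_iff, Subtype.ext_iff]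
    exact pow_ne_zero _ (MvPolynomial.X_ne_zero _)
  have h0 : (vermaQuotFin l δ k).u₀ ≠ 0 := fun h => hne (by rw [← hf, h, map_zero])
  have hspan := span_H_pow hg hw hs
  have hsimple : IsSimpleModule (U l) (vermaQuotFin l δ k).carrier :=
    -- The only `j` with `2δ+j = 0` is `k`, and `H^{k+1} u₀` has been killed.
    isSimpleModule_of_span_H_pow hg hw h0 hspan fun j hj => by
      have : (j : ℂ) = k := by linear_combination hj - hk
      rw [Nat.cast_inj.1 this, hH]
  -- Schur's lemma: a map out of a simple module is injective or zero, and `f` does not kill `u₀`.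
  have hinj : Function.Injective f := f.injective_or_eq_zero.resolve_right fun h =>
    hne (by rw [← hf, h, LinearMap.zero_apply])
  let f' : (vermaQuotFin l δ k).carrier →ₗ[ℂ] M.carrier :=
    { toFun := f, map_add' := map_add f, map_smul' := map_complex_smul f }
  have hsurj : Function.Surjective f' := by
    rw [← LinearMap.range_eq_top, eq_top_iff]
    rintro v -
    obtain ⟨g, rfl⟩ := e.surjective v
    have : ⊤ ≤ (LinearMap.range f').comap e.toLinearMap := by
      rw [← span_symPower (l := l), Submodule.span_le]
      rintro _ ⟨j, rfl⟩
      refine ⟨ι l (H l) ^ j • (vermaQuotFin l δ k).u₀, ?_⟩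
      change f _ = e _
      rw [map_smul, hf, hpow]
    exact this (Submodule.mem_top (x := g))
  let E := LinearEquiv.ofBijective f' ⟨hinj, hsurj⟩
  let v : Fin (k + 1) → (vermaQuotFin l δ k).carrier :=
    fun j => ι l (H l) ^ (j : ℕ) • (vermaQuotFin l δ k).u₀
  -- `C^j H^j u₀` is `u₀` times a product whose factors could vanish only at `i = k`, whereas `i < j
  -- ≤ k`.
  have hv0 : ∀ j, v j ≠ 0 := by
    intro j hj
    have h1 := C_pow_smul_H_pow hw (j : ℕ)
    rw [show ι l (H l) ^ (j : ℕ) • (vermaQuotFin l δ k).u₀ = 0 from hj, smul_zero, eq_comm,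
      smul_eq_zero, or_iff_left h0, Finset.prod_eq_zero_iff] at h1
    obtain ⟨i, hi, hi'⟩ := h1
    rw [mul_eq_zero, or_iff_right (Nat.cast_add_one_ne_zero i)] at hi'
    have : (i : ℂ) = k := by linear_combination hi' - hk
    have := Nat.cast_inj.1 this
    have := Finset.mem_range.1 hi
    omega
  -- These are eigenvectors of `D` for the distinct eigenvalues `δ + j`.
  have hli : LinearIndependent ℂ v :=
    Module.End.eigenvectors_linearIndependent' (actHom (ι l (D l))) (fun j : Fin (k + 1)
      => δ + (j : ℕ))
      (fun i j hij => Fin.ext (Nat.cast_injective (add_left_cancel hij))) v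
      fun j => ⟨Module.End.mem_eigenspace_iff.2 (D_smul_H_pow hw (j : ℕ)), hv0 j⟩
  have hvtop : ⊤ ≤ Submodule.span ℂ (Set.range v) := by
    rw [← hspan, Submodule.span_le]
    rintro _ ⟨j, rfl⟩
    rcases lt_or_ge j (k + 1) with h | h
    · exact Submodule.subset_span ⟨⟨j, h⟩, rfl⟩
    · simp only
      rw [show j = j - (k + 1) + (k + 1) by omega, pow_add, mul_smul, hH, smul_zero]
      exact zero_mem _
  let b := Module.Basis.mk hli hvtop
  refine ⟨⟨hw.isLowestWeight hg h0, hsimple⟩, ⟨E.trans e.symm, fun x v => ?_⟩,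
    b.finiteDimensional_of_finite, ?_⟩
  · rw [LinearEquiv.trans_apply, LinearEquiv.symm_apply_eq, LinearEquiv.trans_apply]
    obtain ⟨g, hg⟩ := e.surjective (E v)
    rw [← hg, LinearEquiv.symm_apply_apply]
    refine ((map_smul f (ι l x) v).trans ?_).trans (he x g)
    exact congrArg _ hg.symm
  · rw [Module.finrank_eq_card_basis b, Fintype.card_fin]

end zero

end

theorem theorem2 (l : ℕ) (hl : 1 ≤ l) (δ p : ℂ) :
    (p ≠ 0 →
      (l = 1 → (verma l δ p).IsIrreducibleLowestWeight δ p) ∧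
      (2 ≤ l →
        (vermaQuot l δ p l).IsIrreducibleLowestWeight δ p ∧
        (∀ a : ℕ, 2 ≤ a → a ≤ l →
          CGA.ι l (CGA.P l (l - a)) • (vermaQuot l δ p l).u₀ =
            ((∏ i ∈ Finset.Icc 2 a, ((l : ℂ) + i)) /
                ((a.factorial : ℂ) * p ^ (a - 1) * ((l : ℂ) + 1) ^ (a - 1))) •
              (CGA.ι l (CGA.P l (l - 1)) ^ a) • (vermaQuot l δ p l).u₀) ∧
        (∃ b : Module.Basis (ℕ × ℕ) ℂ (vermaQuot l δ p l).carrier, ∀ k m : ℕ,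
          b (k, m) = (CGA.ι l (CGA.H l) ^ k * CGA.ι l (CGA.P l (l - 1)) ^ m) •
            (vermaQuot l δ p l).u₀) ∧
        ¬ FiniteDimensional ℂ (vermaQuot l δ p l).carrier)) ∧
    (p = 0 →
      (∀ k : ℕ, 2 * δ + k = 0 →
        (vermaQuotFin l δ k).IsIrreducibleLowestWeight δ 0 ∧
        (vermaQuotFin l δ k).IsoSL2 (symPowerRep k) ∧
        FiniteDimensional ℂ (vermaQuotFin l δ k).carrier ∧
        Module.finrank ℂ (vermaQuotFin l δ k).carrier = k + 1 ∧
        ((k : ℝ) + 1 = 2 * ‖δ‖ + 1)) ∧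
      ((∀ k : ℕ, 2 * δ + k ≠ 0) →
        (vermaQuotZero l δ l).IsIrreducibleLowestWeight δ 0 ∧
        (vermaQuotZero l δ l).IsoSL2 (lowestWeightRep δ) ∧
        ¬ FiniteDimensional ℂ (vermaQuotZero l δ l).carrier)) := by
  refine ⟨fun hp => ⟨?_, fun hl' => ?_⟩, ?_⟩
  -- For `l = 1` no quotient is taken: `vermaQuot` at index `1` is the Verma module by definition.
  · rintro rfl
    exact (vermaQuot_structure le_rfl hp).1
  · obtain ⟨hirr, b, hb⟩ := vermaQuot_structure (δ := δ) hl hp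
    exact ⟨hirr, fun a h h' => smul_u₀_eq_of_singularVector_eq_zero hp
      ((vermaQuot_spec l).2.2.1 a h h'), ⟨b, hb⟩, not_finiteDimensional_of_basis b⟩
  · rintro -
    refine ⟨fun k hk => ?_, vermaQuotZero_structure⟩
    obtain ⟨h1, h2, h3, h4⟩ := vermaQuotFin_structure (l := l) hk
    refine ⟨h1, h2, h3, h4, ?_⟩
    have h : 2 * δ = -(k : ℂ) := by linear_combination hk
    have := congrArg norm h
    rw [norm_mul, norm_neg, Complex.norm_natCast, Complex.norm_two] at this
    rw [this]
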